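/- Fix $n\ge 1$ and consider an $n\times n$ input-queued switch in discrete time with queue lengths $q(t)\in\mathbb Z_{\ge0}^{n\times n}$. In slot $t$, $a_{ij}(t)$ packets arrive at queue $(i,j)$; the $a_{ij}(t)$ are nonnegative integers, bounded by a constant $a_{\max}$, i.i.d. over $t$ and independent over $(i,j)$. The MaxWeight algorithm picks a permutation matrix $s(t)$ that maximizes $\langle q(t),s\rangle$ over all permutation matrices $s$ (ties are broken by an arbitrary, possibly random, rule depending only on $q(t)$), and $q_{ij}(t+1)=\max\{q_{ij}(t)+a_{ij}(t)-s_{ij}(t),0\}$; given $q(t)$, the choice of $s(t)$ is independent of $a(t)$. A steady-state queue length matrix $\bar q$ is a random matrix whose law is an invariant probability distribution of the Markov chain $q(t)$. Let $\nu$ be a point in the relative interior of the set of doubly stochastic $n\times n$ matrices (all ports saturated) with $\nu_{\min}=\min_{ij}\nu_{ij}>0$, and let $k\in\mathbb R_{\ge 0}^{n\times n}$ with $\sum_{ij}k_{ij}=n$; put $\kappa_i=\sum_jk_{ij}$, $\tilde\kappa_j=\sum_ik_{ij}$, $\|k\|^2=\sum_{ij}k_{ij}^2$ and $\epsilon_0=\nu_{\min}/(2\|k\|)$.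 For $0<\epsilon\le\epsilon_0$ consider switches under MaxWeight whose arrivals, bounded by the same $a_{\max}$, have mean matrix $\lambda^{(\epsilon)}=\nu-\epsilon k$ and variances $(\sigma^{(\epsilon)}_{ij})^2$; write $\|\sigma^{(\epsilon)}\|^2=\sum_{ij}(\sigma^{(\epsilon)}_{ij})^2$. (a) If all $\kappa_i$ and $\tilde\kappa_j$ are positive, then for each such switch the Markov chain $q(t)$ has exactly one invariant probability distribution. (b) Let $\alpha\in\mathbb R^{n\times n}$ satisfy $\sum_j\alpha_{ij}=n\kappa_i$ for all $i$ and $\sum_i\alpha_{ij}=n\tilde\kappa_j$ for all $j$ (negative entries are allowed). There are functions $B_3,B_4$ of $\epsilon$, depending only on $n,\nu,k,a_{\max},\alpha$, with $\lim_{\epsilon\downarrow0}\epsilon B_3(\epsilon)=\lim_{\epsilon\downarrow0}\epsilon B_4(\epsilon)=0$, such that for all $0<\epsilon\le\epsilon_0$ and every such switch with a steady-state queue length matrix $\bar q^{(\epsilon)}$, the variable $\langle\bar q^{(\epsilon)},\alpha\rangle=\sum_{ij}\alpha_{ij}\bar q^{(\epsilon)}_{ij}$ is integrable and $$\Bigl(1-\frac1{2n}\Bigr)\frac{\|\sigma^{(\epsilon)}\|^2}{\epsilon}-B_3(\epsilon)\le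 \mathbb E\bigl[\langle\bar q^{(\epsilon)},\alpha\rangle\bigr]\le\Bigl(1-\frac1{2n}\Bigr)\frac{\|\sigma^{(\epsilon)}\|^2}{\epsilon}+B_4(\epsilon).$$ (c) Consequently, for $\alpha$ as in (b) and any family of such switches, one for each $0<\epsilon\le\epsilon_0$, with steady-state matrices $\bar q^{(\epsilon)}$ and $(\sigma^{(\epsilon)}_{ij})^2\to\sigma_{ij}^2$ for all $i,j$ as $\epsilon\downarrow0$, $$\lim_{\epsilon\downarrow0}\epsilon\,\mathbb E\bigl[\langle\bar q^{(\epsilon)},\alpha\rangle\bigr]=\Bigl(1-\frac1{2n}\Bigr)\|\sigma\|^2,\qquad \|\sigma\|^2=\sum_{ij}\sigma_{ij}^2.$$ -/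

import Mathlib

namespace Switch

/-- The capacity region of the `n × n` switch: nonnegative rate matrices all of whose row sums and
column sums are at most `1`. -/
def capacityRegion (n : ℕ) : Set (Fin n → Fin n → ℝ) :=
  {x | (∀ i j, 0 ≤ x i j) ∧ (∀ i, ∑ j, x i j ≤ 1) ∧ (∀ j, ∑ i, x i j ≤ 1)}

/-- The face of the capacity region on which the first `n₁` input ports (rows) and the first `n₂`
output ports (columns) are saturated. -/
def saturatedFace (n n₁ n₂ : ℕ) : Set (Fin n → Fin n → ℝ) :=
  {x | x ∈ capacityRegion n ∧ (∀ i : Fin n, (i : ℕ) < n₁ → ∑ j, x i j = 1) ∧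
    (∀ j : Fin n, (j : ℕ) < n₂ → ∑ i, x i j = 1)}

/-- The smallest entry of a matrix (used for `1 ≤ n`). -/
noncomputable def minEntry {n : ℕ} (x : Fin n → Fin n → ℝ) : ℝ :=
  ⨅ ij : Fin n × Fin n, x ij.1 ij.2

/-- The Euclidean norm of a matrix viewed as a vector with `n ^ 2` components. -/
noncomputable def euclNorm {n : ℕ} (x : Fin n → Fin n → ℝ) : ℝ :=
  Real.sqrt (∑ i, ∑ j, x i j ^ 2)

/-- The largest heavy-traffic parameter considered. When all ports are saturated the positive
constant attached to `ν` is just the smallest entry of `ν`. -/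
noncomputable def epsMax {n : ℕ} (ν k : Fin n → Fin n → ℝ) : ℝ :=
  minEntry ν / (2 * euclNorm k)

/-- Queue length matrices: `q i j` packets wait at input `i` for output `j`. -/
abbrev QueueState (n : ℕ) : Type := Fin n → Fin n → ℕ

/-- The inner product of a queue length matrix with a real weight matrix. -/
def weightedSum {n : ℕ} (α : Fin n → Fin n → ℝ) (q : QueueState n) : ℝ :=
  ∑ i, ∑ j, (q i j : ℝ) * α i j

/-- The joint law of the arrivals in one time slot: the arrivals to different queues are
independent, those to queue `(i, j)` have law `p i j`. -/
noncomputable def arrivalLaw {n : ℕ} (p : Fin n → Fin n → PMF ℕ) : MeasureTheory.Measure (QueueState n) :=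
  MeasureTheory.Measure.pi fun i => MeasureTheory.Measure.pi fun j => (p i j).toMeasure

/-- Mean number of arrivals to queue `(i, j)` in a slot. -/
noncomputable def arrivalMean {n : ℕ} (p : Fin n → Fin n → PMF ℕ) (i j : Fin n) : ℝ :=
  ∫ x, (x : ℝ) ∂(p i j).toMeasure

/-- Variance of the number of arrivals to queue `(i, j)` in a slot. -/
noncomputable def arrivalVar {n : ℕ} (p : Fin n → Fin n → PMF ℕ) (i j : Fin n) : ℝ :=
  ProbabilityTheory.variance (fun x : ℕ => (x : ℝ)) (p i j).toMeasure

/-- The arrivals never exceed `amax` per queue and slot and have mean matrix `lam`. -/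
structure IsArrival {n : ℕ} (amax : ℕ) (lam : Fin n → Fin n → ℝ)
    (p : Fin n → Fin n → PMF ℕ) : Prop where
  le_amax : ∀ i j, ∀ x ∈ (p i j).support, x ≤ amax
  mean_eq : ∀ i j, arrivalMean p i j = lam i j

/-- A version of the MaxWeight algorithm. Maximal schedules are the perfect matchings of inputs to
outputs, i.e. the permutations `s` (input `i` is connected to output `s i`). Given the queue
lengths, a schedule of maximal weight is chosen; ties may be broken in any (possibly random) way
that depends on the current queue lengths only. -/
structure MaxWeight (n : ℕ) where
  schedule : QueueState n → PMF (Equiv.Perm (Fin n))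
  weight_le : ∀ q, ∀ s ∈ (schedule q).support, ∀ t : Equiv.Perm (Fin n),
    ∑ i, q i (t i) ≤ ∑ i, q i (s i)

/-- One slot of the queue dynamics, `q⁺ = max (q + a - s) 0` entrywise (the subtraction of natural
numbers truncates at `0`). -/
def nextQueue {n : ℕ} (q : QueueState n) (s : Equiv.Perm (Fin n)) (a : QueueState n) :
    QueueState n :=
  fun i j => q i j + a i j - (if s i = j then 1 else 0)

/-- The transition kernel of the queue length Markov chain: from `q` draw a schedule by `P` and,
independently, arrivals from `arrivalLaw p`. -/
noncomputable def queueKernel {n : ℕ} (p : Fin n → Fin n → PMF ℕ) (P : MaxWeight n) :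
    ProbabilityTheory.Kernel (QueueState n) (QueueState n) :=
  ProbabilityTheory.Kernel.ofFunOfCountable fun q =>
    ∑ s : Equiv.Perm (Fin n), P.schedule q s • (arrivalLaw p).map (nextQueue q s)

/-- `μ` is a steady-state law of the queue lengths: a probability measure that is invariant under
the queue length chain. -/
def IsSteadyState {n : ℕ} (p : Fin n → Fin n → PMF ℕ) (P : MaxWeight n)
    (μ : MeasureTheory.Measure (QueueState n)) : Prop :=
  MeasureTheory.IsProbabilityMeasure μ ∧ (queueKernel p P).Invariant μ

end Switch

/-!
The schedule `s(t)` maximizes the weight, so the drift of `q(t)` points towards the cone `K` of the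
matrices `w i + w' j` with nonnegative entries: by the quadratic Lyapunov function `dist(q, K)²`,
the distance to `K` has a second moment in steady state that is bounded uniformly in `ε`.

The heavy-traffic constant comes from the projection `π` onto the span of `K`. Since `π s` is the
same matrix for all schedules `s`, the drift of `‖π q‖²` involves only the arrivals, whose
contribution is `(2/n - 1/n²) ‖σ‖² - 2 ε ⟪π q, k⟫` up to `O(ε²)`, and the unused service `u`, whose
mean total is `ε ∑ k`. On the coordinates where `u` is positive the next queue length vanishes, so
`⟪π q⁺, u⟫` is controlled by the distance of `q⁺` to `K`; Young's inequality with weight `√ε` makes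
this term `O(√ε)`. In steady state the drift has mean zero, and the row and column sums of `α` say
exactly that `π α = n π k`.

If all ports are underloaded, `‖q‖²` has negative drift for large `q`, so the Cesàro means of the
laws of `q(t)` are tight and their limit points are invariant; the invariant law is unique because
the empty state can be reached from everywhere.
-/

namespace Switch

open MeasureTheory ProbabilityTheory Filter Topology
open scoped ENNReal RealInnerProductSpace

section Drift

variable {X : Type*} [MeasurableSpace X] {κ : Kernel X X} {μ : Measure X}

theorem lintegral_lintegral_of_invariant (h : κ.Invariant μ) {f : X → ℝ≥0∞} (hf : Measurable f) :
    ∫⁻ x, ∫⁻ y, f y ∂κ x ∂μ = ∫⁻ x, f x ∂μ := by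
  conv_rhs => rw [← h.def]
  rw [Measure.lintegral_bind κ.aemeasurable hf.aemeasurable]

theorem integral_integral_of_invariant [SFinite μ] [IsSFiniteKernel κ] (h : κ.Invariant μ)
    {f : X → ℝ} (hf : Integrable f μ) :
    Integrable (fun x => ∫ y, f y ∂κ x) μ ∧ ∫ x, ∫ y, f y ∂κ x ∂μ = ∫ x, f x ∂μ := by
  have hμ : (κ ∘ₖ Kernel.const Unit μ) () = μ := by
    rw [← Measure.comp_eq_comp_const_apply]
    exact h.def
  have hf' : Integrable f ((κ ∘ₖ Kernel.const Unit μ) ()) := by rwa [hμ]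
  refine ⟨by simpa using hf'.integral_comp, ?_⟩
  have hcomp := Kernel.integral_comp hf'
  rw [hμ, Kernel.const_apply] at hcomp
  exact hcomp.symm

variable [IsMarkovKernel κ] [IsProbabilityMeasure μ]

-- Truncating `W` at `M` makes it integrable, so that it can be cancelled by invariance.
theorem setLIntegral_le_of_drift (h : κ.Invariant μ) {W f : X → ℝ≥0∞} {b M : ℝ≥0∞}
    (hW : Measurable W) (hd : ∀ x, ∫⁻ y, W y ∂κ x + f x ≤ W x + b) (hM : M ≠ ∞) :
    ∫⁻ x in {x | W x ≤ M}, f x ∂μ ≤ b := by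
  have hmin : Measurable fun x => min (W x) M := hW.min measurable_const
  have hfin : ∫⁻ x, min (W x) M ∂μ ≠ ∞ :=
    ne_top_of_le_ne_top hM <| (lintegral_mono fun x => min_le_right _ _).trans_eq (by simp)
  have hdrift (x : X) :
      ∫⁻ y, min (W y) M ∂κ x + {x | W x ≤ M}.indicator f x ≤ min (W x) M + b := by
    by_cases hx : W x ≤ M
    · rw [Set.indicator_of_mem (s := {x | W x ≤ M}) hx, min_eq_left hx]
      exact (add_le_add_left (lintegral_mono fun y => min_le_left _ _) _).trans (hd x)
    · rw [Set.indicator_of_notMem (s := {x | W x ≤ M}) hx, add_zero, min_eq_right (not_le.1 hx).le]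
      exact (lintegral_mono fun y => min_le_right _ _).trans (by simp)
  rw [← lintegral_indicator (measurableSet_le hW measurable_const)]
  refine (ENNReal.add_le_add_iff_left hfin).1 ?_
  calc ∫⁻ x, min (W x) M ∂μ + ∫⁻ x, {x | W x ≤ M}.indicator f x ∂μ
      = ∫⁻ x, (∫⁻ y, min (W y) M ∂κ x + {x | W x ≤ M}.indicator f x) ∂μ := by
        rw [lintegral_add_left hmin.lintegral_kernel, lintegral_lintegral_of_invariant h hmin]
    _ ≤ ∫⁻ x, (min (W x) M + b) ∂μ := lintegral_mono hdrift
    _ = ∫⁻ x, min (W x) M ∂μ + b := by rw [lintegral_add_left hmin]; simp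

theorem lintegral_le_of_drift (h : κ.Invariant μ) {W f : X → ℝ≥0∞} {b : ℝ≥0∞}
    (hW : Measurable W) (hW' : ∀ x, W x ≠ ∞) (hd : ∀ x, ∫⁻ y, W y ∂κ x + f x ≤ W x + b) :
    ∫⁻ x, f x ∂μ ≤ b := by
  have hmono : Monotone fun N : ℕ => {x | W x ≤ N} := fun M N hMN x hx =>
    le_trans (α := ℝ≥0∞) hx (by exact_mod_cast hMN)
  have huniv : ⋃ N : ℕ, {x | W x ≤ N} = Set.univ := Set.eq_univ_of_forall fun x =>
    Set.mem_iUnion.2 ((ENNReal.exists_nat_gt (hW' x)).imp fun _ hN => hN.le)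
  rw [← setLIntegral_univ, ← huniv, setLIntegral_iUnion_of_directed _ hmono.directed_le]
  exact iSup_le fun N => setLIntegral_le_of_drift h hW hd (ENNReal.natCast_ne_top N)

theorem integrable_of_drift (h : κ.Invariant μ) {w f : X → ℝ} {b : ℝ} (hwm : Measurable w)
    (hfm : AEStronglyMeasurable f μ) (hw : ∀ x, 0 ≤ w x) (hf : ∀ x, 0 ≤ f x) (hb : 0 ≤ b)
    (hint : ∀ x, Integrable w (κ x)) (hd : ∀ x, ∫ y, w y ∂κ x + f x ≤ w x + b) :
    Integrable f μ ∧ ∫ x, f x ∂μ ≤ b := by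
  have hle : ∫⁻ x, ENNReal.ofReal (f x) ∂μ ≤ ENNReal.ofReal b := by
    refine lintegral_le_of_drift h hwm.ennreal_ofReal (fun x => ENNReal.ofReal_ne_top) fun x => ?_
    rw [← ofReal_integral_eq_lintegral_ofReal (hint x) (ae_of_all _ hw),
      ← ENNReal.ofReal_add (integral_nonneg hw) (hf x), ← ENNReal.ofReal_add (hw x) hb]
    exact ENNReal.ofReal_le_ofReal (hd x)
  refine ⟨⟨hfm, ?_⟩, ?_⟩
  · rw [hasFiniteIntegral_iff_ofReal (ae_of_all _ hf)]
    exact hle.trans_lt ENNReal.ofReal_lt_top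
  · rw [integral_eq_lintegral_of_nonneg_ae (ae_of_all _ hf) hfm]
    exact ENNReal.toReal_le_of_le_ofReal hb hle

/-- The bound on the stationary second moment of a nonnegative function whose increments are at
most `B` and whose square has drift at most `-2 * c * d + K`. -/
noncomputable def momentBound (c K B : ℝ) : ℝ :=
  ((3 / 2 * (K + B ^ 2)) ^ 2 / (4 * c) + B ^ 3) / (2 * c)

theorem cube_le_of_abs_sub_le {a b B : ℝ} (ha : 0 ≤ a) (hb : 0 ≤ b) (h : |b - a| ≤ B) :
    b ^ 3 ≤ 3 / 2 * a * b ^ 2 + (a ^ 3 - 3 / 2 * a ^ 3 + B ^ 2 * (3 / 2 * a + B)) := by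
  obtain ⟨hlo, hup⟩ := abs_le.1 h
  have hrem : (b - a) ^ 2 * (b + a / 2) ≤ B ^ 2 * (3 / 2 * a + B) :=
    mul_le_mul (sq_le_sq' hlo hup) (by linarith) (by linarith) (sq_nonneg _)
  linear_combination hrem

theorem integrable_pow_of_abs_sub_le {ρ : Measure X} [IsFiniteMeasure ρ] {d : X → ℝ} {a B : ℝ}
    (hdm : Measurable d) (h : ∀ᵐ y ∂ρ, |d y - a| ≤ B) (m : ℕ) :
    Integrable (fun y => d y ^ m) ρ := by
  refine Integrable.of_bound (hdm.pow_const m).aestronglyMeasurable ((|a| + B) ^ m) ?_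
  filter_upwards [h] with y hy
  rw [norm_pow, Real.norm_eq_abs]
  exact pow_le_pow_left₀ (abs_nonneg _) (by linarith [abs_sub_abs_le_abs_sub (d y) a]) m

theorem integral_cube_le_of_drift {d : X → ℝ} {c K B : ℝ} (hc : 0 < c) (hdm : Measurable d)
    (hd : ∀ x, 0 ≤ d x) (x : X) (hinc : ∀ᵐ y ∂κ x, |d y - d x| ≤ B)
    (hdrift : ∫ y, d y ^ 2 ∂κ x ≤ d x ^ 2 - 2 * c * d x + K) :
    ∫ y, d y ^ 3 ∂κ x + 2 * c * d x ^ 2 ≤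
      d x ^ 3 + ((3 / 2 * (K + B ^ 2)) ^ 2 / (4 * c) + B ^ 3) := by
  have hpow := integrable_pow_of_abs_sub_le hdm hinc
  have hcube : ∫ y, d y ^ 3 ∂κ x ≤ 3 / 2 * d x * ∫ y, d y ^ 2 ∂κ x +
      (d x ^ 3 - 3 / 2 * d x ^ 3 + B ^ 2 * (3 / 2 * d x + B)) := by
    calc ∫ y, d y ^ 3 ∂κ x
        ≤ ∫ y, (3 / 2 * d x * d y ^ 2 +
          (d x ^ 3 - 3 / 2 * d x ^ 3 + B ^ 2 * (3 / 2 * d x + B))) ∂κ x := by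
          refine integral_mono_ae (hpow 3) (((hpow 2).const_mul _).add (integrable_const _)) ?_
          filter_upwards [hinc] with y hy using cube_le_of_abs_sub_le (hd x) (hd y) hy
      _ = _ := by
          rw [integral_add ((hpow 2).const_mul _) (integrable_const _), integral_const_mul]
          simp
  have hsq : 3 / 2 * d x * ∫ y, d y ^ 2 ∂κ x ≤ 3 / 2 * d x * (d x ^ 2 - 2 * c * d x + K) :=
    mul_le_mul_of_nonneg_left hdrift (mul_nonneg (by norm_num) (hd x))
  have hyoung : 3 / 2 * (K + B ^ 2) * d x ≤ c * d x ^ 2 + (3 / 2 * (K + B ^ 2)) ^ 2 / (4 * c) := by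
    have hnonneg : 0 ≤ (2 * c * d x - 3 / 2 * (K + B ^ 2)) ^ 2 / (4 * c) := by positivity
    have hexpand : (2 * c * d x - 3 / 2 * (K + B ^ 2)) ^ 2 / (4 * c)
        = c * d x ^ 2 - 3 / 2 * (K + B ^ 2) * d x + (3 / 2 * (K + B ^ 2)) ^ 2 / (4 * c) := by
      field_simp
      ring
    linarith
  linear_combination hcube + hsq + hyoung

theorem integrable_sq_of_drift (h : κ.Invariant μ) {d : X → ℝ} {c K B : ℝ} (hc : 0 < c)
    (hB : 0 ≤ B) (hdm : Measurable d) (hd : ∀ x, 0 ≤ d x)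
    (hinc : ∀ x, ∀ᵐ y ∂κ x, |d y - d x| ≤ B)
    (hdrift : ∀ x, ∫ y, d y ^ 2 ∂κ x ≤ d x ^ 2 - 2 * c * d x + K) :
    Integrable (fun x => d x ^ 2) μ ∧ ∫ x, d x ^ 2 ∂μ ≤ momentBound c K B := by
  obtain ⟨hint, hle⟩ := integrable_of_drift h (w := fun x => d x ^ 3)
    (f := fun x => 2 * c * d x ^ 2) (b := (3 / 2 * (K + B ^ 2)) ^ 2 / (4 * c) + B ^ 3)
    (hdm.pow_const 3) ((hdm.pow_const 2).const_mul _).aestronglyMeasurable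
    (fun x => pow_nonneg (hd x) 3) (fun x => by positivity) (by positivity)
    (fun x => integrable_pow_of_abs_sub_le hdm (hinc x) 3)
    fun x => integral_cube_le_of_drift hc hdm hd x (hinc x) (hdrift x)
  rw [integral_const_mul] at hle
  refine ⟨(integrable_const_mul_iff (by positivity : 2 * c ≠ 0).isUnit _).1 hint, ?_⟩
  rw [momentBound, le_div_iff₀ (by positivity)]
  linarith

theorem abs_integral_sub_le_of_abs_sub_le {ρ : Measure X} [IsProbabilityMeasure ρ] {F : X → ℝ}
    {a B : ℝ} (hF : Integrable F ρ) (h : ∀ᵐ y ∂ρ, |F y - a| ≤ B) : |∫ y, F y ∂ρ - a| ≤ B := by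
  have hsub : ∫ y, F y ∂ρ - a = ∫ y, (F y - a) ∂ρ := by
    simp [integral_sub hF (integrable_const a)]
  simpa [hsub] using norm_integral_le_of_norm_le_const (f := fun y => F y - a) h

theorem integrable_min_const {ρ : Measure X} [IsFiniteMeasure ρ] {F : X → ℝ} (hFm : Measurable F)
    (hF : ∀ x, 0 ≤ F x) {M : ℝ} (hM : 0 ≤ M) : Integrable (fun y => min (F y) M) ρ := by
  refine Integrable.of_bound (hFm.min measurable_const).aestronglyMeasurable M
    (ae_of_all _ fun y => ?_)
  rw [Real.norm_of_nonneg (le_min (hF y) hM)]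
  exact min_le_right _ _

theorem integral_drift_min_eq_zero (h : κ.Invariant μ) {F : X → ℝ} (hFm : Measurable F)
    (hF : ∀ x, 0 ≤ F x) {M : ℝ} (hM : 0 ≤ M) :
    ∫ x, (∫ y, min (F y) M ∂κ x - min (F x) M) ∂μ = 0 := by
  have hmin := integrable_min_const (ρ := μ) hFm hF hM
  obtain ⟨hint, heq⟩ := integral_integral_of_invariant h hmin
  rw [integral_sub hint hmin, heq, sub_self]

-- `F` need not be integrable: the bounded increments dominate the drifts of its truncations.
theorem integral_drift_eq_zero (h : κ.Invariant μ) {F : X → ℝ} {B : ℝ} (hB : 0 ≤ B)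
    (hFm : Measurable F) (hF : ∀ x, 0 ≤ F x) (hinc : ∀ x, ∀ᵐ y ∂κ x, |F y - F x| ≤ B) :
    ∫ x, (∫ y, F y ∂κ x - F x) ∂μ = 0 := by
  have hlim : Tendsto (fun M : ℕ => ∫ x, (∫ y, min (F y) M ∂κ x - min (F x) M) ∂μ) atTop
      (𝓝 (∫ x, (∫ y, F y ∂κ x - F x) ∂μ)) := by
    refine tendsto_integral_of_dominated_convergence (fun _ => B) (fun M => ?_)
      (integrable_const _) (fun M => ae_of_all _ fun x => ?_) (ae_of_all _ fun x => ?_)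
    · have hmin : Measurable fun x => min (F x) (M : ℝ) := hFm.min measurable_const
      exact (hmin.stronglyMeasurable.integral_kernel.sub
        hmin.stronglyMeasurable).aestronglyMeasurable
    · refine abs_integral_sub_le_of_abs_sub_le
        (integrable_min_const hFm hF (Nat.cast_nonneg M)) ?_
      filter_upwards [hinc x] with y hy
      exact (abs_min_sub_min_le_max _ _ _ _).trans (max_le hy (by simpa using hB))
    · refine tendsto_const_nhds.congr' ?_
      filter_upwards [eventually_ge_atTop ⌈F x + B⌉₊] with M hM
      have hM' : F x + B ≤ M := Nat.ceil_le.1 hM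
      rw [min_eq_left (by linarith)]
      congr 1
      refine integral_congr_ae ?_
      filter_upwards [hinc x] with y hy
      rw [min_eq_left (by linarith [(abs_le.1 hy).2])]
  simp_rw [integral_drift_min_eq_zero h hFm hF (Nat.cast_nonneg _)] at hlim
  exact tendsto_nhds_unique hlim tendsto_const_nhds

end Drift

section Uniqueness

variable {X : Type*} [MeasurableSpace X] {κ : Kernel X X}

theorem bind_le_of_le_of_invariant {m ρ : Measure X} (hle : m ≤ ρ) (hρ : κ.Invariant ρ) :
    m.bind κ ≤ ρ := by
  rw [← hρ.def]
  refine Measure.le_iff.2 fun s hs => ?_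
  rw [Measure.bind_apply hs κ.aemeasurable, Measure.bind_apply hs κ.aemeasurable]
  exact lintegral_mono' hle le_rfl

theorem invariant_of_bind_le [IsMarkovKernel κ] {m : Measure X} [IsFiniteMeasure m]
    (hle : m.bind κ ≤ m) : κ.Invariant m := by
  have : IsFiniteMeasure (m.bind κ) := isFiniteMeasure_of_le m hle
  refine Measure.eq_of_le_of_measure_univ_eq hle ?_
  rw [Measure.bind_apply MeasurableSet.univ κ.aemeasurable]
  simp

theorem invariant_inf [IsMarkovKernel κ] {μ₁ μ₂ : Measure X} [IsFiniteMeasure μ₁]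
    (h₁ : κ.Invariant μ₁) (h₂ : κ.Invariant μ₂) : κ.Invariant (μ₁ ⊓ μ₂) := by
  have : IsFiniteMeasure (μ₁ ⊓ μ₂) := isFiniteMeasure_of_le μ₁ inf_le_left
  exact invariant_of_bind_le <| le_inf (bind_le_of_le_of_invariant inf_le_left h₁)
    (bind_le_of_le_of_invariant inf_le_right h₂)

theorem invariant_sub {m ρ : Measure X} [IsFiniteMeasure m] (hle : m ≤ ρ)
    (hm : κ.Invariant m) (hρ : κ.Invariant ρ) : κ.Invariant (ρ - m) := by
  have hsplit : κ ∘ₘ (ρ - m) + κ ∘ₘ m = ρ - m + m := by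
    rw [← Measure.comp_add, Measure.sub_add_cancel_of_le hle, hρ.def]
  rw [hm.def] at hsplit
  exact (Measure.add_left_inj _ _ _).1 hsplit

theorem min_measure_singleton_le_inf [MeasurableSingletonClass X] (μ₁ μ₂ : Measure X) (x : X) :
    min (μ₁ {x}) (μ₂ {x}) ≤ (μ₁ ⊓ μ₂) {x} := by
  have hdirac {ρ : Measure X} {c : ℝ≥0∞} (hc : c ≤ ρ {x}) : c • Measure.dirac x ≤ ρ := by
    refine Measure.le_iff.2 fun s hs => ?_
    by_cases hx : x ∈ s
    · simpa [hs, hx] using hc.trans (measure_mono (Set.singleton_subset_iff.2 hx))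
    · simp [hs, hx]
  simpa using Measure.le_iff'.1
    (le_inf (hdirac (min_le_left (μ₁ {x}) (μ₂ {x}))) (hdirac (min_le_right _ _))) {x}

/-- The state `y` can be reached from `x` in finitely many transitions of positive probability. -/
def Accessible (κ : Kernel X X) (x y : X) : Prop :=
  Relation.ReflTransGen (fun u v => κ u {v} ≠ 0) x y

variable [Countable X] [MeasurableSingletonClass X]

theorem measure_singleton_eq_zero_of_step {m : Measure X} (h : κ.Invariant m) {x y : X}
    (hy : m {y} = 0) (hxy : κ x {y} ≠ 0) : m {x} = 0 := by
  have hae : ∀ᵐ z ∂m, κ z {y} = 0 := by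
    rwa [← h.def, Measure.bind_apply (measurableSet_singleton y) κ.aemeasurable,
      lintegral_eq_zero_iff (κ.measurable_coe (measurableSet_singleton y))] at hy
  by_contra hx
  exact hxy (ae_iff_of_countable.1 hae x hx)

theorem eq_zero_of_invariant_of_accessible {m : Measure X} (h : κ.Invariant m) {x₀ : X}
    (hacc : ∀ x, Accessible κ x x₀) (h₀ : m {x₀} = 0) : m = 0 := by
  refine Measure.ext_of_singleton fun x => ?_
  induction hacc x using Relation.ReflTransGen.head_induction_on with
  | refl => simpa using h₀
  | head hstep _ ih => simpa using measure_singleton_eq_zero_of_step h (by simpa using ih) hstep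

theorem eq_of_le_of_invariant_of_accessible [IsMarkovKernel κ] {m ρ : Measure X}
    [IsFiniteMeasure ρ] (hle : m ≤ ρ) (hm : κ.Invariant m) (hρ : κ.Invariant ρ) {x₀ : X}
    (hacc : ∀ x, Accessible κ x x₀) (h₀ : ρ {x₀} ≤ m {x₀}) : ρ = m := by
  have : IsFiniteMeasure m := isFiniteMeasure_of_le ρ hle
  have hzero : ρ - m = 0 := by
    refine eq_zero_of_invariant_of_accessible (invariant_sub hle hm hρ) hacc ?_
    rw [Measure.sub_apply (measurableSet_singleton x₀) hle, tsub_eq_zero_of_le h₀]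
  rw [← Measure.sub_add_cancel_of_le hle, hzero, zero_add]

theorem eq_of_invariant_of_accessible [IsMarkovKernel κ] {μ₁ μ₂ : Measure X}
    [IsProbabilityMeasure μ₁] [IsProbabilityMeasure μ₂] (h₁ : κ.Invariant μ₁)
    (h₂ : κ.Invariant μ₂) {x₀ : X} (hacc : ∀ x, Accessible κ x x₀) : μ₁ = μ₂ := by
  have hinf := invariant_inf h₁ h₂
  rcases min_le_iff.1 (min_measure_singleton_le_inf μ₁ μ₂ x₀) with h₀ | h₀
  · have heq := eq_of_le_of_invariant_of_accessible inf_le_left hinf h₁ hacc h₀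
    exact Measure.eq_of_le_of_isProbabilityMeasure (heq.trans_le inf_le_right)
  · have heq := eq_of_le_of_invariant_of_accessible inf_le_right hinf h₂ hacc h₀
    exact (Measure.eq_of_le_of_isProbabilityMeasure (heq.trans_le inf_le_left)).symm

end Uniqueness

section Existence

variable {X : Type*} [MeasurableSpace X]

theorem isTightMeasureSet_of_lintegral_le [TopologicalSpace X] {S : Set (Measure X)}
    {f : X → ℝ≥0∞} (hfm : Measurable f) (hf : ∀ R : ℕ, IsCompact {x | f x < R}) {C : ℝ≥0∞}
    (hC : C ≠ ∞) (hS : ∀ ρ ∈ S, ∫⁻ x, f x ∂ρ ≤ C) : IsTightMeasureSet S := by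
  rw [isTightMeasureSet_iff_exists_isCompact_measure_compl_le]
  intro ε hε
  obtain ⟨R, hR⟩ := ENNReal.exists_nat_gt (ENNReal.div_ne_top hC hε.ne')
  refine ⟨{x | f x < R}, hf R, fun ρ hρ => ?_⟩
  have hcompl : {x | f x < R}ᶜ = {x | (R : ℝ≥0∞) ≤ f x} := by
    ext
    simp
  have hR₀ : (R : ℝ≥0∞) ≠ 0 := (zero_le.trans_lt hR).ne'
  rw [hcompl]
  calc ρ {x | (R : ℝ≥0∞) ≤ f x} ≤ (∫⁻ x, f x ∂ρ) / R :=
        meas_ge_le_lintegral_div hfm.aemeasurable hR₀ (ENNReal.natCast_ne_top R)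
    _ ≤ C / R := by gcongr; exact hS ρ hρ
    _ ≤ ε := ENNReal.div_le_of_le_mul' <|
        (ENNReal.div_le_iff_le_mul (.inl hε.ne') (.inr hR₀)).1 hR.le

variable (κ : Kernel X X) (x₀ : X)

/-- The law of the chain with kernel `κ` after `N` steps from `x₀`. -/
noncomputable def iterLaw : ℕ → Measure X
  | 0 => Measure.dirac x₀
  | N + 1 => (iterLaw N).bind κ

/-- The average of the first `N + 1` laws of the chain with kernel `κ` started at `x₀`. -/
noncomputable def cesaroLaw (N : ℕ) : Measure X :=
  ((N : ℝ≥0∞) + 1)⁻¹ • ∑ m ∈ Finset.range (N + 1), iterLaw κ x₀ m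

theorem lintegral_iterLaw_succ {g : X → ℝ≥0∞} (hg : Measurable g) (N : ℕ) :
    ∫⁻ x, g x ∂iterLaw κ x₀ (N + 1) = ∫⁻ x, ∫⁻ y, g y ∂κ x ∂iterLaw κ x₀ N :=
  Measure.lintegral_bind κ.aemeasurable hg.aemeasurable

theorem lintegral_cesaroLaw (g : X → ℝ≥0∞) (N : ℕ) :
    ∫⁻ x, g x ∂cesaroLaw κ x₀ N
      = ((N : ℝ≥0∞) + 1)⁻¹ * ∑ m ∈ Finset.range (N + 1), ∫⁻ x, g x ∂iterLaw κ x₀ m := by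
  rw [cesaroLaw, lintegral_smul_measure, lintegral_finsetSum_measure, smul_eq_mul]

theorem lintegral_lintegral_cesaroLaw_add {g : X → ℝ≥0∞} (hg : Measurable g) (N : ℕ) :
    ∫⁻ x, ∫⁻ y, g y ∂κ x ∂cesaroLaw κ x₀ N + ((N : ℝ≥0∞) + 1)⁻¹ * ∫⁻ x, g x ∂iterLaw κ x₀ 0
      = ∫⁻ x, g x ∂cesaroLaw κ x₀ N
        + ((N : ℝ≥0∞) + 1)⁻¹ * ∫⁻ x, g x ∂iterLaw κ x₀ (N + 1) := by
  rw [lintegral_cesaroLaw, lintegral_cesaroLaw, ← mul_add, ← mul_add]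
  simp_rw [← lintegral_iterLaw_succ κ x₀ hg]
  rw [← Finset.sum_range_succ' fun m => ∫⁻ x, g x ∂iterLaw κ x₀ m, Finset.sum_range_succ]

variable [IsMarkovKernel κ]

instance isProbabilityMeasure_iterLaw (N : ℕ) : IsProbabilityMeasure (iterLaw κ x₀ N) := by
  induction N with
  | zero => exact Measure.dirac.isProbabilityMeasure
  | succ N ih =>
    refine ⟨?_⟩
    rw [iterLaw, Measure.bind_apply MeasurableSet.univ κ.aemeasurable]
    simp

instance isProbabilityMeasure_cesaroLaw (N : ℕ) : IsProbabilityMeasure (cesaroLaw κ x₀ N) := by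
  refine ⟨?_⟩
  rw [← lintegral_one, lintegral_cesaroLaw]
  simpa using ENNReal.inv_mul_cancel (a := (N : ℝ≥0∞) + 1) (by simp) (by simp)

theorem lintegral_iterLaw_add_sum_le {V f : X → ℝ≥0∞} {b : ℝ≥0∞} (hV : Measurable V)
    (hf : Measurable f) (hd : ∀ x, ∫⁻ y, V y ∂κ x + f x ≤ V x + b) (N : ℕ) :
    ∫⁻ x, V x ∂iterLaw κ x₀ N + ∑ m ∈ Finset.range N, ∫⁻ x, f x ∂iterLaw κ x₀ m
      ≤ V x₀ + N * b := by
  induction N with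
  | zero => simp [iterLaw, lintegral_dirac' _ hV]
  | succ N ih =>
    have hstep : ∫⁻ x, V x ∂iterLaw κ x₀ (N + 1) + ∫⁻ x, f x ∂iterLaw κ x₀ N
        ≤ ∫⁻ x, V x ∂iterLaw κ x₀ N + b := by
      rw [lintegral_iterLaw_succ κ x₀ hV, ← lintegral_add_right _ hf]
      refine (lintegral_mono hd).trans_eq ?_
      rw [lintegral_add_left hV]
      simp
    rw [Finset.sum_range_succ]
    calc _ = (∫⁻ x, V x ∂iterLaw κ x₀ (N + 1) + ∫⁻ x, f x ∂iterLaw κ x₀ N)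
          + ∑ m ∈ Finset.range N, ∫⁻ x, f x ∂iterLaw κ x₀ m := by ring
      _ ≤ (∫⁻ x, V x ∂iterLaw κ x₀ N + b)
          + ∑ m ∈ Finset.range N, ∫⁻ x, f x ∂iterLaw κ x₀ m := by gcongr
      _ = (∫⁻ x, V x ∂iterLaw κ x₀ N + ∑ m ∈ Finset.range N, ∫⁻ x, f x ∂iterLaw κ x₀ m)
          + b := by ring
      _ ≤ (V x₀ + N * b) + b := by gcongr
      _ = V x₀ + (N + 1 : ℕ) * b := by push_cast; ring

theorem lintegral_cesaroLaw_le {V f : X → ℝ≥0∞} {b : ℝ≥0∞} (hV : Measurable V)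
    (hf : Measurable f) (hd : ∀ x, ∫⁻ y, V y ∂κ x + f x ≤ V x + b) (N : ℕ) :
    ∫⁻ x, f x ∂cesaroLaw κ x₀ N ≤ V x₀ + b := by
  rw [lintegral_cesaroLaw]
  calc ((N : ℝ≥0∞) + 1)⁻¹ * ∑ m ∈ Finset.range (N + 1), ∫⁻ x, f x ∂iterLaw κ x₀ m
      ≤ ((N : ℝ≥0∞) + 1)⁻¹ * (((N : ℝ≥0∞) + 1) * (V x₀ + b)) := by
        gcongr
        refine (le_of_add_le_right
          (lintegral_iterLaw_add_sum_le κ x₀ hV hf hd (N + 1))).trans ?_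
        push_cast
        rw [mul_add]
        gcongr
        exact le_mul_of_one_le_left zero_le le_add_self
    _ = V x₀ + b := by
        rw [← mul_assoc, ENNReal.inv_mul_cancel (by simp) (by simp), one_mul]

variable {κ}

theorem tendsto_lintegral_of_le_one [TopologicalSpace X] [DiscreteTopology X]
    [OpensMeasurableSpace X] {ι : Type*} {l : Filter ι} {ρ : ι → ProbabilityMeasure X}
    {π : ProbabilityMeasure X} (hρ : Tendsto ρ l (𝓝 π)) {g : X → ℝ≥0∞} (hg : ∀ x, g x ≤ 1) :
    Tendsto (fun i => ∫⁻ x, g x ∂(ρ i : Measure X)) l (𝓝 (∫⁻ x, g x ∂(π : Measure X))) := by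
  have hfin (x : X) : g x ≠ ∞ := ne_top_of_le_ne_top ENNReal.one_ne_top (hg x)
  have hle (x : X) : ((g x).toNNReal : ℝ) ≤ 1 :=
    ENNReal.toReal_le_of_le_ofReal zero_le_one (by simpa using hg x)
  have hdist (x y : X) : dist (g x).toNNReal (g y).toNNReal ≤ 1 := by
    rw [NNReal.dist_eq]
    exact abs_sub_le_of_nonneg_of_le (NNReal.coe_nonneg _) (hle x) (NNReal.coe_nonneg _) (hle y)
  simpa [ENNReal.coe_toNNReal (hfin _)] using
    (ProbabilityMeasure.tendsto_iff_forall_lintegral_tendsto.1 hρ)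
      (BoundedContinuousFunction.mkOfBound
        ⟨fun x => (g x).toNNReal, continuous_of_discreteTopology⟩ 1 hdist)

theorem tendsto_inv_succ_mul_of_le_one {c : ℕ → ℝ≥0∞} (hc : ∀ N, c N ≤ 1) :
    Tendsto (fun N : ℕ => ((N : ℝ≥0∞) + 1)⁻¹ * c N) atTop (𝓝 0) := by
  have hinv : Tendsto (fun N : ℕ => ((N : ℝ≥0∞) + 1)⁻¹) atTop (𝓝 0) := by
    simpa using (tendsto_add_atTop_iff_nat 1).2 ENNReal.tendsto_inv_nat_nhds_zero
  exact tendsto_of_tendsto_of_tendsto_of_le_of_le tendsto_const_nhds hinv (fun _ => zero_le)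
    fun N => mul_le_of_le_one_right zero_le (hc N)

theorem invariant_of_tendsto_cesaroLaw [TopologicalSpace X] [DiscreteTopology X] [BorelSpace X]
    [Countable X] {x₀ : X} {l : Filter ℕ} [l.NeBot] (hl : l ≤ atTop) {π : ProbabilityMeasure X}
    (hπ : Tendsto (β := ProbabilityMeasure X) (fun N => ⟨cesaroLaw κ x₀ N, inferInstance⟩) l
      (𝓝 π)) :
    κ.Invariant (π : Measure X) := by
  refine Measure.ext_of_singleton fun y => ?_
  have hy := measurableSet_singleton y
  set g : X → ℝ≥0∞ := Set.indicator {y} 1 with hg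
  have hg₁ (x : X) : g x ≤ 1 := Set.indicator_le_self' (by simp) x
  have hg₂ (ρ : Measure X) [IsProbabilityMeasure ρ] : ∫⁻ x, g x ∂ρ ≤ 1 := by
    rw [hg, lintegral_indicator_one hy]
    exact prob_le_one
  have hleft := (tendsto_lintegral_of_le_one hπ fun x => hg₂ (κ x)).add
    ((tendsto_inv_succ_mul_of_le_one fun _ => hg₂ (iterLaw κ x₀ 0)).mono_left hl)
  have hright := (tendsto_lintegral_of_le_one hπ hg₁).add
    ((tendsto_inv_succ_mul_of_le_one fun N => hg₂ (iterLaw κ x₀ (N + 1))).mono_left hl)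
  have heq := tendsto_nhds_unique
    (hleft.congr (lintegral_lintegral_cesaroLaw_add κ x₀ (measurable_const.indicator hy))) hright
  simp_rw [add_zero, hg, lintegral_indicator_one hy] at heq
  rw [Measure.bind_apply hy κ.aemeasurable, heq]

theorem exists_invariant_of_drift [DiscreteMeasurableSpace X] [Countable X] {V f : X → ℝ≥0∞}
    {b : ℝ≥0∞} (x₀ : X) (hV : V x₀ ≠ ∞) (hb : b ≠ ∞) (hf : ∀ R : ℕ, {x | f x < R}.Finite)
    (hd : ∀ x, ∫⁻ y, V y ∂κ x + f x ≤ V x + b) :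
    ∃ μ : Measure X, IsProbabilityMeasure μ ∧ κ.Invariant μ := by
  let _ : TopologicalSpace X := ⊥
  have : DiscreteTopology X := ⟨rfl⟩
  let A (N : ℕ) : ProbabilityMeasure X := ⟨cesaroLaw κ x₀ N, inferInstance⟩
  have htight : IsTightMeasureSet {((ρ : ProbabilityMeasure X) : Measure X) | ρ ∈ Set.range A} := by
    refine isTightMeasureSet_of_lintegral_le .of_discrete (fun R => (hf R).isCompact)
      (ENNReal.add_ne_top.2 ⟨hV, hb⟩) ?_
    rintro _ ⟨_, ⟨N, rfl⟩, rfl⟩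
    exact lintegral_cesaroLaw_le κ x₀ .of_discrete .of_discrete hd N
  have hmem : (hyperfilter ℕ).map A ≤ 𝓟 (closure (Set.range A)) :=
    tendsto_principal.2 <| Eventually.of_forall fun N => subset_closure ⟨N, rfl⟩
  obtain ⟨π, -, hπ⟩ := isCompact_iff_ultrafilter_le_nhds.1
    (isCompact_closure_of_isTightMeasureSet htight) _ hmem
  exact ⟨π, inferInstance, invariant_of_tendsto_cesaroLaw Nat.hyperfilter_le_atTop hπ⟩

end Existence

section Birkhoff

variable {m R : Type*} [Fintype m] [DecidableEq m] [Field R] [LinearOrder R] [IsStrictOrderedRing R]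

theorem exists_perm_sum_mul_le_of_mem_doublyStochastic (w : Matrix m m R) {x : Matrix m m R}
    (hx : x ∈ doublyStochastic R m) :
    ∃ σ : Equiv.Perm m, ∑ i, ∑ j, w i j * x i j ≤ ∑ i, w i (σ i) := by
  obtain ⟨c, hc0, hc1, rfl⟩ := exists_eq_sum_perm_of_mem_doublyStochastic hx
  have hsum : ∑ i, ∑ j, w i j * (∑ σ, c σ • σ.permMatrix R) i j = ∑ σ, c σ * ∑ i, w i (σ i) := by
    simp only [Matrix.sum_apply, Matrix.smul_apply, Equiv.Perm.permMatrix, Equiv.toPEquiv,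
      PEquiv.toMatrix_apply, smul_eq_mul, Finset.mul_sum]
    rw [Finset.sum_congr rfl fun i _ => Finset.sum_comm, Finset.sum_comm]
    simp [mul_comm]
  by_contra! hlt
  refine lt_irrefl (∑ σ, c σ * ∑ i, w i (σ i)) ?_
  obtain ⟨τ, -, hτ⟩ := Finset.exists_lt_of_sum_lt (s := Finset.univ) (f := 0) (g := c)
    (by simp [hc1])
  calc ∑ σ, c σ * ∑ i, w i (σ i)
      < ∑ σ, c σ * ∑ i, ∑ j, w i j * (∑ σ, c σ • σ.permMatrix R) i j :=
        Finset.sum_lt_sum (fun σ _ => mul_le_mul_of_nonneg_left (hlt σ).le (hc0 σ))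
          ⟨τ, Finset.mem_univ τ, mul_lt_mul_of_pos_left (hlt τ) hτ⟩
    _ = ∑ σ, c σ * ∑ i, w i (σ i) := by rw [← Finset.sum_mul, hc1, one_mul, hsum]

theorem exists_mem_doublyStochastic_ge {x : Matrix m m R} (h0 : ∀ i j, 0 ≤ x i j)
    (hrow : ∀ i, ∑ j, x i j ≤ 1) (hcol : ∀ j, ∑ i, x i j ≤ 1) :
    ∃ y ∈ doublyStochastic R m, ∀ i j, x i j ≤ y i j := by
  set r : m → R := fun i => 1 - ∑ j, x i j with hr
  set c : m → R := fun j => 1 - ∑ i, x i j with hc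
  have hr0 : ∀ i, 0 ≤ r i := fun i => sub_nonneg.2 (hrow i)
  have hc0 : ∀ j, 0 ≤ c j := fun j => sub_nonneg.2 (hcol j)
  have hrc : ∑ i, r i = ∑ j, c j := by
    simp only [hr, hc, Finset.sum_sub_distrib]
    rw [Finset.sum_comm]
  -- If there is no deficit then `T = 0`, all `r i` and `c j` vanish, and `y = x`.
  set T := ∑ i, r i with hT
  have hrT : ∀ i, r i * T / T = r i := fun i => mul_div_cancel_of_imp fun h0 =>
    (Finset.sum_eq_zero_iff_of_nonneg fun i _ => hr0 i).1 h0 i (Finset.mem_univ i)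
  have hcT : ∀ j, T * c j / T = c j := fun j => by
    rw [mul_comm]
    exact mul_div_cancel_of_imp fun h0 =>
      (Finset.sum_eq_zero_iff_of_nonneg fun j _ => hc0 j).1 (hrc ▸ h0) j (Finset.mem_univ j)
  have hadd : ∀ i j, 0 ≤ r i * c j / T := fun i j =>
    div_nonneg (mul_nonneg (hr0 i) (hc0 j)) (Finset.sum_nonneg fun i _ => hr0 i)
  refine ⟨fun i j => x i j + r i * c j / T, mem_doublyStochastic_iff_sum.2
    ⟨fun i j => add_nonneg (h0 i j) (hadd i j), fun i => ?_, fun j => ?_⟩,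
    fun i j => le_add_of_nonneg_right (hadd i j)⟩
  · rw [Finset.sum_add_distrib, ← Finset.sum_div, ← Finset.mul_sum, ← hrc, hrT]
    exact add_sub_cancel _ _
  · rw [Finset.sum_add_distrib, ← Finset.sum_div, ← Finset.sum_mul, ← hT, hcT]
    exact add_sub_cancel _ _

omit [DecidableEq m] in
theorem exists_perm_sum_mul_le {w x : Matrix m m R} (hw : ∀ i j, 0 ≤ w i j)
    (h0 : ∀ i j, 0 ≤ x i j) (hrow : ∀ i, ∑ j, x i j ≤ 1) (hcol : ∀ j, ∑ i, x i j ≤ 1) :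
    ∃ σ : Equiv.Perm m, ∑ i, ∑ j, w i j * x i j ≤ ∑ i, w i (σ i) := by
  classical
  obtain ⟨y, hy, hxy⟩ := exists_mem_doublyStochastic_ge h0 hrow hcol
  obtain ⟨σ, hσ⟩ := exists_perm_sum_mul_le_of_mem_doublyStochastic w hy
  refine ⟨σ, le_trans (Finset.sum_le_sum fun i _ => Finset.sum_le_sum fun j _ => ?_) hσ⟩
  exact mul_le_mul_of_nonneg_left (hxy i j) (hw i j)

end Birkhoff

section ConeProjection

variable {H : Type*} [NormedAddCommGroup H] [InnerProductSpace ℝ H] [CompleteSpace H]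

theorem exists_mem_properCone_norm_sub_eq_infDist (K : ProperCone ℝ H) (x : H) :
    ∃ y ∈ K, ‖x - y‖ = Metric.infDist x K ∧ ⟪x - y, y⟫ = 0 ∧ ∀ z ∈ K, ⟪x - y, z⟫ ≤ 0 := by
  obtain ⟨y, hyK, hy⟩ :=
    exists_norm_eq_iInf_of_complete_convex K.nonempty K.isClosed.isComplete K.convex x
  have hle := (norm_eq_iInf_iff_real_inner_le_zero K.convex hyK).1 hy
  have hdir : ∀ z ∈ K, ⟪x - y, z⟫ ≤ 0 := fun z hz => by
    simpa using hle (y + z) (K.toSubmodule.add_mem hyK hz)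
  have hy0 : 0 ≤ ⟪x - y, y⟫ := by simpa using hle 0 K.toSubmodule.zero_mem
  refine ⟨y, hyK, ?_, (hdir y hyK).antisymm hy0, hdir⟩
  simp only [hy, Metric.infDist_eq_iInf, dist_eq_norm]

end ConeProjection

section EuclideanMatrices

variable {I J : Type*}

/-- The Euclidean space of real matrices with rows indexed by `I` and columns by `J`. -/
abbrev EuclMatrix (I J : Type*) : Type _ := EuclideanSpace ℝ (I × J)

/-- A matrix as a vector of the Euclidean space `EuclMatrix I J`. -/
noncomputable def vec : (I → J → ℝ) ≃ₗ[ℝ] EuclMatrix I J :=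
  (LinearEquiv.curry ℝ ℝ I J).symm ≪≫ₗ (WithLp.linearEquiv 2 ℝ (I × J → ℝ)).symm

@[simp]
theorem vec_apply (x : I → J → ℝ) (i : I) (j : J) : vec x (i, j) = x i j := rfl

variable [Fintype I] [Fintype J]

theorem inner_eq_sum (x y : EuclMatrix I J) : ⟪x, y⟫ = ∑ i, ∑ j, x (i, j) * y (i, j) := by
  simp [PiLp.inner_apply, Fintype.sum_prod_type, mul_comm]

theorem inner_nonneg_of_apply_nonneg {x y : EuclMatrix I J} (hx : ∀ i j, 0 ≤ x (i, j))
    (hy : ∀ i j, 0 ≤ y (i, j)) : 0 ≤ ⟪x, y⟫ := by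
  rw [inner_eq_sum]
  exact Finset.sum_nonneg fun i _ => Finset.sum_nonneg fun j _ => mul_nonneg (hx i j) (hy i j)

theorem norm_vec {n : ℕ} (x : Fin n → Fin n → ℝ) : ‖vec x‖ = euclNorm x := by
  simp [EuclideanSpace.norm_eq, euclNorm, Fintype.sum_prod_type]

theorem abs_apply_le_norm (x : EuclMatrix I J) (i : I) (j : J) : |x (i, j)| ≤ ‖x‖ :=
  PiLp.norm_apply_le x (i, j)

theorem norm_le_of_abs_apply_le {n : ℕ} {x : EuclMatrix (Fin n) (Fin n)} {c : ℝ} (hc : 0 ≤ c)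
    (hx : ∀ i j, |x (i, j)| ≤ c) : ‖x‖ ≤ n * c := by
  refine le_of_sq_le_sq ?_ (by positivity)
  calc ‖x‖ ^ 2 = ∑ ij, x ij ^ 2 := by simp [EuclideanSpace.norm_sq_eq]
    _ ≤ ∑ _ij : Fin n × Fin n, c ^ 2 :=
        Finset.sum_le_sum fun ij _ => sq_le_sq.2 ((hx ij.1 ij.2).trans (le_abs_self c))
    _ = (n * c) ^ 2 := by simp; ring

variable (J) in
/-- The indicator matrix of the row `i`; its inner product with a matrix is the `i`-th row sum. -/
noncomputable def rowVec [DecidableEq I] (i : I) : EuclMatrix I J :=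
  vec fun i' _ => if i' = i then 1 else 0

variable (I) in
/-- The indicator matrix of the column `j`; its inner product with a matrix is the `j`-th column
sum. -/
noncomputable def colVec [DecidableEq J] (j : J) : EuclMatrix I J :=
  vec fun _ j' => if j' = j then 1 else 0

@[simp]
theorem inner_rowVec [DecidableEq I] (i : I) (x : EuclMatrix I J) :
    ⟪rowVec J i, x⟫ = ∑ j, x (i, j) := by
  simp [inner_eq_sum, rowVec]

@[simp]
theorem inner_colVec [DecidableEq J] (j : J) (x : EuclMatrix I J) :
    ⟪colVec I j, x⟫ = ∑ i, x (i, j) := by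
  simp [inner_eq_sum, colVec]

end EuclideanMatrices

section Collapse

variable {I J : Type*} [Fintype I] [Fintype J]

variable (I J) in
/-- The subspace of the matrices `x i j = u i + v j`, onto which the queue lengths collapse in heavy
traffic. -/
def collapseSpace : Submodule ℝ (EuclMatrix I J) where
  carrier := {x | ∃ (u : I → ℝ) (v : J → ℝ), ∀ i j, x (i, j) = u i + v j}
  zero_mem' := ⟨0, 0, fun i j => by simp⟩
  add_mem' := by
    rintro x y ⟨u, v, hx⟩ ⟨u', v', hy⟩
    exact ⟨u + u', v + v', fun i j => by simp only [PiLp.add_apply, hx, hy, Pi.add_apply]; ring⟩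
  smul_mem' := by
    rintro c x ⟨u, v, hx⟩
    exact ⟨c • u, c • v, fun i j => by simp [hx, mul_add]⟩

variable (I J) in
/-- The cone of the nonnegative matrices in `collapseSpace I J`. -/
def collapseCone : ProperCone ℝ (EuclMatrix I J) where
  carrier := {x | x ∈ collapseSpace I J ∧ 0 ≤ x.ofLp}
  zero_mem' := ⟨zero_mem _, fun _ => le_rfl⟩
  add_mem' hx hy := ⟨add_mem hx.1 hy.1, fun ij => add_nonneg (hx.2 ij) (hy.2 ij)⟩
  smul_mem' c _ hx :=
    ⟨Submodule.smul_mem _ c.1 hx.1, fun ij => mul_nonneg c.2 (hx.2 ij)⟩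
  isClosed' := by
    refine (collapseSpace I J).closed_of_finiteDimensional.inter ?_
    exact isClosed_Ici.preimage (PiLp.continuous_ofLp 2 fun _ : I × J => ℝ)

/-- The distance of a matrix from `collapseCone I J`. -/
noncomputable def collapseDist (x : EuclMatrix I J) : ℝ :=
  Metric.infDist x (collapseCone I J)

theorem collapseDist_nonneg (x : EuclMatrix I J) : 0 ≤ collapseDist x := Metric.infDist_nonneg

theorem collapseDist_le_norm_sub {x y : EuclMatrix I J} (hy : y ∈ collapseCone I J) :
    collapseDist x ≤ ‖x - y‖ :=
  (Metric.infDist_le_dist_of_mem hy).trans_eq (dist_eq_norm x y)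

theorem abs_collapseDist_sub_le (x y : EuclMatrix I J) :
    |collapseDist x - collapseDist y| ≤ ‖x - y‖ := by
  simpa [collapseDist, Real.dist_eq, dist_eq_norm] using
    (Metric.lipschitz_infDist_pt (collapseCone I J : Set (EuclMatrix I J))).dist_le_mul x y

theorem norm_sub_starProjection_le_collapseDist (x : EuclMatrix I J) :
    ‖x - (collapseSpace I J).starProjection x‖ ≤ collapseDist x := by
  obtain ⟨y, hy, hxy, -⟩ := exists_mem_properCone_norm_sub_eq_infDist (collapseCone I J) x
  rw [collapseDist, ← hxy, Submodule.starProjection_minimal]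
  exact ciInf_le ⟨0, by rintro _ ⟨z, rfl⟩; exact norm_nonneg _⟩
    (⟨y, hy.1⟩ : collapseSpace I J)

theorem mem_orthogonal_collapseSpace {x : EuclMatrix I J} (hrow : ∀ i, ∑ j, x (i, j) = 0)
    (hcol : ∀ j, ∑ i, x (i, j) = 0) : x ∈ (collapseSpace I J)ᗮ := by
  rintro y ⟨u, v, hy⟩
  calc ⟪y, x⟫ = ∑ i, ∑ j, u i * x (i, j) + ∑ i, ∑ j, v j * x (i, j) := by
        simp only [inner_eq_sum, hy, add_mul, Finset.sum_add_distrib]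
    _ = 0 := by
        rw [Finset.sum_comm (f := fun i j => v j * x (i, j))]
        simp only [← Finset.mul_sum, hrow, hcol, mul_zero, Finset.sum_const_zero, add_zero]

theorem rowVec_mem_collapseCone [DecidableEq I] (i : I) : rowVec J i ∈ collapseCone I J := by
  refine ⟨⟨fun i' => if i' = i then 1 else 0, 0, fun i' j => by simp [rowVec]⟩, fun ⟨i', j⟩ => ?_⟩
  by_cases h : i' = i <;> simp [rowVec, h]

theorem colVec_mem_collapseCone [DecidableEq J] (j : J) : colVec I j ∈ collapseCone I J := by
  refine ⟨⟨0, fun j' => if j' = j then 1 else 0, fun i j' => by simp [colVec]⟩, fun ⟨i, j'⟩ => ?_⟩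
  by_cases h : j' = j <;> simp [colVec, h]

theorem starProjection_collapseSpace [Nonempty I] [Nonempty J] (x : EuclMatrix I J) :
    (collapseSpace I J).starProjection x = vec fun i j =>
      (∑ j', x (i, j')) / Fintype.card J + (∑ i', x (i', j)) / Fintype.card I -
        (∑ i', ∑ j', x (i', j')) / (Fintype.card I * Fintype.card J) := by
  have hI : (Fintype.card I : ℝ) ≠ 0 := by simp
  have hJ : (Fintype.card J : ℝ) ≠ 0 := by simp
  refine Submodule.eq_starProjection_of_mem_orthogonal
    ⟨fun i => (∑ j', x (i, j')) / Fintype.card J, fun j => (∑ i', x (i', j)) / Fintype.card I -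
      (∑ i', ∑ j', x (i', j')) / (Fintype.card I * Fintype.card J), fun i j => add_sub_assoc ..⟩
    (mem_orthogonal_collapseSpace (fun i => ?_) fun j => ?_)
  · simp only [PiLp.sub_apply, vec_apply, Finset.sum_sub_distrib, Finset.sum_add_distrib,
      ← Finset.sum_div, Finset.sum_const, Finset.card_univ, nsmul_eq_mul]
    rw [Finset.sum_comm (f := fun j i => x (i, j))]
    field_simp
    ring
  · simp only [PiLp.sub_apply, vec_apply, Finset.sum_sub_distrib, Finset.sum_add_distrib,
      ← Finset.sum_div, Finset.sum_const, Finset.card_univ, nsmul_eq_mul]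
    field_simp
    ring

theorem norm_starProjection_collapseSpace_sq [Nonempty I] [Nonempty J] (x : EuclMatrix I J) :
    ‖(collapseSpace I J).starProjection x‖ ^ 2 =
      (∑ i, (∑ j, x (i, j)) ^ 2) / Fintype.card J + (∑ j, (∑ i, x (i, j)) ^ 2) / Fintype.card I -
        (∑ i, ∑ j, x (i, j)) ^ 2 / (Fintype.card I * Fintype.card J) := by
  rw [← real_inner_self_eq_norm_sq, Submodule.inner_starProjection_left_eq_right,
    Submodule.starProjection_eq_self_iff.2 (Submodule.starProjection_apply_mem _ x),
    starProjection_collapseSpace, inner_eq_sum]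
  simp only [vec_apply, mul_add, mul_sub, Finset.sum_add_distrib, Finset.sum_sub_distrib]
  rw [Finset.sum_comm (f := fun i j => x (i, j) * ((∑ i', x (i', j)) / Fintype.card I))]
  simp only [← Finset.sum_mul, ← mul_div_assoc, ← sq, ← Finset.sum_div]

end Collapse

section MaxWeightGeometry

variable {n : ℕ}

/-- The queue lengths as a vector. -/
noncomputable def queueVec (q : QueueState n) : EuclMatrix (Fin n) (Fin n) :=
  vec fun i j => q i j

/-- The permutation matrix of the schedule `s` as a vector. -/
noncomputable def schedVec (s : Equiv.Perm (Fin n)) : EuclMatrix (Fin n) (Fin n) :=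
  vec fun i j => if s i = j then 1 else 0

@[simp]
theorem queueVec_apply (q : QueueState n) (i j : Fin n) : queueVec q (i, j) = q i j := rfl

@[simp]
theorem schedVec_apply (s : Equiv.Perm (Fin n)) (i j : Fin n) :
    schedVec s (i, j) = if s i = j then 1 else 0 := rfl

theorem sum_schedVec_row (s : Equiv.Perm (Fin n)) (i : Fin n) : ∑ j, schedVec s (i, j) = 1 := by
  simp

theorem sum_schedVec_col (s : Equiv.Perm (Fin n)) (j : Fin n) : ∑ i, schedVec s (i, j) = 1 := by
  simp [← Equiv.eq_symm_apply]

theorem MaxWeight.inner_le_inner_schedVec {P : MaxWeight n} {q : QueueState n}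
    {s : Equiv.Perm (Fin n)} (hs : s ∈ (P.schedule q).support) {x : Fin n → Fin n → ℝ}
    (hx : x ∈ capacityRegion n) : ⟪queueVec q, vec x⟫ ≤ ⟪queueVec q, schedVec s⟫ := by
  obtain ⟨t, ht⟩ := exists_perm_sum_mul_le (w := fun i j => (q i j : ℝ))
    (fun i j => Nat.cast_nonneg _) hx.1 hx.2.1 hx.2.2
  calc ⟪queueVec q, vec x⟫ ≤ ∑ i, (q i (t i) : ℝ) := by simpa [inner_eq_sum] using ht
    _ ≤ ∑ i, (q i (s i) : ℝ) := by exact_mod_cast P.weight_le q s hs t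
    _ = ⟪queueVec q, schedVec s⟫ := by simp [inner_eq_sum]

theorem MaxWeight.inner_sub_schedVec_le {P : MaxWeight n} {q : QueueState n}
    {s : Equiv.Perm (Fin n)} (hs : s ∈ (P.schedule q).support) {x z : Fin n → Fin n → ℝ} {t : ℝ}
    (hx : x + t • z ∈ capacityRegion n) :
    ⟪queueVec q, vec x - schedVec s⟫ ≤ -(t * ⟪queueVec q, vec z⟫) := by
  have h := MaxWeight.inner_le_inner_schedVec hs hx
  rw [map_add, map_smul, inner_add_right, real_inner_smul_right] at h
  rw [inner_sub_right]
  linarith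

theorem MaxWeight.inner_sub_schedVec_le_of_lt_one {P : MaxWeight n} {q : QueueState n}
    {s : Equiv.Perm (Fin n)} (hs : s ∈ (P.schedule q).support) {lam : Fin n → Fin n → ℝ}
    (h0 : ∀ i j, 0 ≤ lam i j) {c : ℝ} (hc : 0 ≤ c) (hrow : ∀ i, ∑ j, lam i j + n * c ≤ 1)
    (hcol : ∀ j, ∑ i, lam i j + n * c ≤ 1) :
    ⟪queueVec q, vec lam - schedVec s⟫ ≤ -(c * ‖queueVec q‖) := by
  -- For `q = 0` the factor `c / ‖q‖` is `0` by convention and both sides vanish.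
  set t : ℝ := c / ‖queueVec q‖ with ht
  have ht0 : 0 ≤ t := by positivity
  have htq : ∀ i j, t * q i j ≤ c := fun i j => by
    rw [ht, div_mul_eq_mul_div]
    refine div_le_of_le_mul₀ (norm_nonneg _) hc (mul_le_mul_of_nonneg_left ?_ hc)
    exact (le_abs_self _).trans (abs_apply_le_norm (queueVec q) i j)
  have hsum : ∀ f : Fin n → ℝ, (∀ i, f i ≤ c) → ∑ i, f i ≤ n * c := fun f hf => by
    simpa using Finset.sum_le_sum fun i (_ : i ∈ Finset.univ) => hf i
  have hmem : lam + t • (fun i j => (q i j : ℝ)) ∈ capacityRegion n := by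
    refine ⟨fun i j => add_nonneg (h0 i j) (mul_nonneg ht0 (Nat.cast_nonneg _)), fun i => ?_,
      fun j => ?_⟩ <;>
    simp only [Pi.add_apply, Pi.smul_apply, smul_eq_mul, Finset.sum_add_distrib]
    · linarith [hsum _ (htq i), hrow i]
    · linarith [hsum _ (htq · j), hcol j]
  refine (MaxWeight.inner_sub_schedVec_le hs hmem).trans_eq ?_
  change -(t * ⟪queueVec q, queueVec q⟫) = _
  rcases eq_or_ne ‖queueVec q‖ 0 with h | h
  · simp [h]
  · rw [real_inner_self_eq_norm_sq, ht]
    field_simp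

theorem add_smul_mem_capacityRegion {ν z : Fin n → Fin n → ℝ} (hν : ν ∈ saturatedFace n n n)
    {t : ℝ} (ht : 0 ≤ t) (hz : ∀ i j, t * |z i j| ≤ ν i j) (hrow : ∀ i, ∑ j, z i j ≤ 0)
    (hcol : ∀ j, ∑ i, z i j ≤ 0) : ν + t • z ∈ capacityRegion n := by
  refine ⟨fun i j => ?_, fun i => ?_, fun j => ?_⟩ <;>
    simp only [Pi.add_apply, Pi.smul_apply, smul_eq_mul, Finset.sum_add_distrib, ← Finset.mul_sum]
  · have := mul_le_mul_of_nonneg_left (neg_abs_le (z i j)) ht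
    linarith [hz i j]
  · linarith [hν.1.2.1 i, mul_nonpos_of_nonneg_of_nonpos ht (hrow i)]
  · linarith [hν.1.2.2 j, mul_nonpos_of_nonneg_of_nonpos ht (hcol j)]

theorem vec_sub_schedVec_mem_orthogonal {ν : Fin n → Fin n → ℝ} (hν : ν ∈ saturatedFace n n n)
    (s : Equiv.Perm (Fin n)) : vec ν - schedVec s ∈ (collapseSpace (Fin n) (Fin n))ᗮ :=
  mem_orthogonal_collapseSpace
    (fun i => by
      simp only [PiLp.sub_apply, Finset.sum_sub_distrib, vec_apply, sum_schedVec_row,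
        hν.2.1 i i.2, sub_self])
    (fun j => by
      simp only [PiLp.sub_apply, Finset.sum_sub_distrib, vec_apply, sum_schedVec_col,
        hν.2.2 j j.2, sub_self])

theorem MaxWeight.exists_mem_collapseCone_inner_sub_le {P : MaxWeight n} {ν : Fin n → Fin n → ℝ}
    (hν : ν ∈ saturatedFace n n n) {m : ℝ} (hm : 0 ≤ m) (hνm : ∀ i j, m ≤ ν i j)
    (q : QueueState n) :
    ∃ y ∈ collapseCone (Fin n) (Fin n), ‖queueVec q - y‖ = collapseDist (queueVec q) ∧
      ∀ s ∈ (P.schedule q).support,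
        ⟪queueVec q - y, vec ν - schedVec s⟫ ≤ -(m * collapseDist (queueVec q)) := by
  obtain ⟨y, hy, hnorm, horth, hpolar⟩ :=
    exists_mem_properCone_norm_sub_eq_infDist (collapseCone (Fin n) (Fin n)) (queueVec q)
  refine ⟨y, hy, hnorm, fun s hs => ?_⟩
  obtain ⟨z, hz⟩ := vec.surjective (queueVec q - y)
  rw [← hz] at hnorm horth hpolar ⊢
  set d := collapseDist (queueVec q)
  -- For `d = 0` the factor `m / d` is `0` by convention and both sides vanish.
  have hmem : ν + (m / d) • z ∈ capacityRegion n := by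
    refine add_smul_mem_capacityRegion hν (div_nonneg hm (collapseDist_nonneg _))
      (fun i j => ?_) (fun i => ?_) fun j => ?_
    · refine le_trans ?_ (hνm i j)
      rw [div_mul_eq_mul_div]
      refine div_le_of_le_mul₀ (collapseDist_nonneg _) hm (mul_le_mul_of_nonneg_left ?_ hm)
      exact (abs_apply_le_norm (vec z) i j).trans_eq hnorm
    · simpa [real_inner_comm] using hpolar _ (rowVec_mem_collapseCone i)
    · simpa [real_inner_comm] using hpolar _ (colVec_mem_collapseCone j)
  have hq : queueVec q = vec z + y := by rw [hz, sub_add_cancel]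
  calc ⟪vec z, vec ν - schedVec s⟫ = ⟪queueVec q, vec ν - schedVec s⟫ := by
        rw [hq, inner_add_left, vec_sub_schedVec_mem_orthogonal hν s y hy.1, add_zero]
    _ ≤ -(m / d * ⟪queueVec q, vec z⟫) := MaxWeight.inner_sub_schedVec_le hs hmem
    _ = -(m / d * d ^ 2) := by
        rw [hq, inner_add_left, real_inner_self_eq_norm_sq, hnorm, real_inner_comm, horth, add_zero]
        rfl
    _ = -(m * d) := by
        rcases eq_or_ne d 0 with h | h
        · simp [h]
        · field_simp

end MaxWeightGeometry

section Arrivals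

theorem ae_toMeasure_mem_support {Ω : Type*} [MeasurableSpace Ω] [DiscreteMeasurableSpace Ω]
    (p : PMF Ω) : ∀ᵐ x ∂p.toMeasure, x ∈ p.support := by
  rw [ae_iff, PMF.toMeasure_apply_eq_zero_iff _ MeasurableSet.of_discrete]
  exact Set.disjoint_left.2 fun _ hx hx' => hx' hx

theorem memLp_of_ae_mem_finite {Ω : Type*} [MeasurableSpace Ω] [DiscreteMeasurableSpace Ω]
    [Countable Ω] {μ : Measure Ω} [IsFiniteMeasure μ] {S : Set Ω} (hS : S.Finite)
    (h : ∀ᵐ x ∂μ, x ∈ S) (f : Ω → ℝ) (r : ℝ≥0∞) : MemLp f r μ := by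
  refine MemLp.of_bound Measurable.of_discrete.aestronglyMeasurable (∑ x ∈ hS.toFinset, ‖f x‖) ?_
  filter_upwards [h] with x hx
  exact Finset.single_le_sum (f := fun x => ‖f x‖) (fun _ _ => norm_nonneg _)
    (hS.mem_toFinset.2 hx)

variable {n : ℕ}

instance isProbabilityMeasure_arrivalLaw (p : Fin n → Fin n → PMF ℕ) :
    IsProbabilityMeasure (arrivalLaw p) := by
  unfold arrivalLaw; infer_instance

theorem measurePreserving_arrivalLaw_eval (p : Fin n → Fin n → PMF ℕ) (i j : Fin n) :
    MeasurePreserving (fun a : QueueState n => a i j) (arrivalLaw p) (p i j).toMeasure :=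
  (measurePreserving_eval (fun j => (p i j).toMeasure) j).comp
    (measurePreserving_eval (fun i => Measure.pi fun j => (p i j).toMeasure) i)

theorem finite_setOf_forall_le (N : ℕ) : {a : QueueState n | ∀ i j, a i j ≤ N}.Finite :=
  Set.finite_Iic (fun _ _ => N : QueueState n)

namespace IsArrival

variable {p : Fin n → Fin n → PMF ℕ} {amax : ℕ} {lam : Fin n → Fin n → ℝ}

theorem ae_entry_le (h : IsArrival amax lam p) (i j : Fin n) :
    ∀ᵐ x ∂(p i j).toMeasure, x ≤ amax := by
  filter_upwards [ae_toMeasure_mem_support (p i j)] with x hx using h.le_amax i j x hx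

theorem memLp_entry (h : IsArrival amax lam p) (i j : Fin n) (f : ℕ → ℝ) :
    MemLp f 2 (p i j).toMeasure :=
  memLp_of_ae_mem_finite (Set.finite_Iic amax) (h.ae_entry_le i j) f 2

theorem ae_le (h : IsArrival amax lam p) : ∀ᵐ a ∂arrivalLaw p, ∀ i j, a i j ≤ amax := by
  simp only [ae_all_iff]
  exact fun i j => (measurePreserving_arrivalLaw_eval p i j).quasiMeasurePreserving.ae
    (h.ae_entry_le i j)

theorem integrable (h : IsArrival amax lam p) (f : QueueState n → ℝ) :
    Integrable f (arrivalLaw p) :=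
  memLp_one_iff_integrable.1 (memLp_of_ae_mem_finite (finite_setOf_forall_le amax) h.ae_le f 1)

theorem mean_nonneg (h : IsArrival amax lam p) (i j : Fin n) : 0 ≤ lam i j := by
  rw [← h.mean_eq]
  exact integral_nonneg fun x => Nat.cast_nonneg x

theorem integral_inner (h : IsArrival amax lam p) (c : EuclMatrix (Fin n) (Fin n)) :
    ∫ a, ⟪c, queueVec a⟫ ∂arrivalLaw p = ⟪c, vec lam⟫ := by
  simp only [inner_eq_sum]
  rw [integral_finsetSum _ fun i _ => h.integrable _]
  refine Finset.sum_congr rfl fun i _ => ?_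
  rw [integral_finsetSum _ fun j _ => h.integrable _]
  refine Finset.sum_congr rfl fun j _ => ?_
  rw [integral_const_mul, vec_apply, ← h.mean_eq i j, arrivalMean,
    ← (measurePreserving_arrivalLaw_eval p i j).map_eq,
    integral_map Measurable.of_discrete.aemeasurable
      Measurable.of_discrete.aestronglyMeasurable]
  rfl

theorem variance_inner (h : IsArrival amax lam p) (c : EuclMatrix (Fin n) (Fin n)) :
    variance (fun a => ⟪c, queueVec a⟫) (arrivalLaw p) =
      ∑ i, ∑ j, c (i, j) ^ 2 * arrivalVar p i j := by
  have hm : ∀ i j, MemLp (fun x : ℕ => c (i, j) * (x : ℝ)) 2 (p i j).toMeasure :=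
    fun i j => h.memLp_entry i j _
  have hrow : ∀ i, MemLp (∑ j, fun y : Fin n → ℕ => c (i, j) * (y j : ℝ)) 2
      (Measure.pi fun j => (p i j).toMeasure) := fun i =>
    memLp_finsetSum' _ fun j _ => (hm i j).comp_measurePreserving (measurePreserving_eval _ j)
  have hsum : (fun a : QueueState n => ⟪c, queueVec a⟫) =
      ∑ i, fun a : QueueState n => (∑ j, fun y : Fin n → ℕ => c (i, j) * (y j : ℝ)) (a i) := by
    ext a
    simp [inner_eq_sum]
  rw [hsum, arrivalLaw, variance_sum_pi hrow]
  refine Finset.sum_congr rfl fun i _ => ?_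
  rw [variance_sum_pi (hm i)]
  exact Finset.sum_congr rfl fun j _ => variance_const_mul _ _ _

theorem integral_inner_sub_sq (h : IsArrival amax lam p) (c : EuclMatrix (Fin n) (Fin n)) :
    ∫ a, ⟪c, queueVec a - vec lam⟫ ^ 2 ∂arrivalLaw p =
      ∑ i, ∑ j, c (i, j) ^ 2 * arrivalVar p i j := by
  rw [← h.variance_inner, variance_eq_integral Measurable.of_discrete.aemeasurable,
    h.integral_inner]
  simp only [inner_sub_right]

theorem apply_zero_ne_zero (h : IsArrival amax lam p) {i j : Fin n} (hlt : lam i j < 1) :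
    p i j 0 ≠ 0 := by
  intro h0
  have hge : ∀ᵐ x ∂(p i j).toMeasure, (1 : ℝ) ≤ ((x : ℕ) : ℝ) := by
    filter_upwards [ae_toMeasure_mem_support (p i j)] with x hx
    exact_mod_cast Nat.one_le_iff_ne_zero.2 fun hx0 => hx (by rwa [hx0])
  have hmean : 1 ≤ arrivalMean p i j := by
    simpa [arrivalMean] using integral_mono_ae (integrable_const (1 : ℝ))
      ((h.memLp_entry i j fun x => (x : ℝ)).integrable one_le_two) hge
  exact hlt.not_ge (h.mean_eq i j ▸ hmean)

theorem arrivalLaw_zero_ne_zero (h : IsArrival amax lam p) (hlt : ∀ i j, lam i j < 1) :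
    arrivalLaw p {0} ≠ 0 := by
  have hrow : ∀ i, (Measure.pi fun j => (p i j).toMeasure) {0} ≠ 0 := fun i => by
    rw [Measure.pi_singleton, Finset.prod_ne_zero_iff]
    intro j _
    rw [PMF.toMeasure_apply_singleton _ _ (measurableSet_singleton _)]
    exact h.apply_zero_ne_zero (hlt i j)
  rw [arrivalLaw, Measure.pi_singleton, Finset.prod_ne_zero_iff]
  exact fun i _ => hrow i

end IsArrival

end Arrivals

section Slot

variable {n : ℕ}

local instance measurableSpacePerm : MeasurableSpace (Equiv.Perm (Fin n)) := ⊤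

/-- The joint law of the schedule and of the arrivals in a slot that starts from the queue lengths
`q`. -/
noncomputable def slotLaw (p : Fin n → Fin n → PMF ℕ) (P : MaxWeight n) (q : QueueState n) :
    Measure (Equiv.Perm (Fin n) × QueueState n) :=
  (P.schedule q).toMeasure.prod (arrivalLaw p)

instance isProbabilityMeasure_slotLaw (p : Fin n → Fin n → PMF ℕ) (P : MaxWeight n)
    (q : QueueState n) : IsProbabilityMeasure (slotLaw p P q) := by
  unfold slotLaw; infer_instance

theorem queueKernel_eq_map_slotLaw (p : Fin n → Fin n → PMF ℕ) (P : MaxWeight n)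
    (q : QueueState n) :
    queueKernel p P q = (slotLaw p P q).map fun ω => nextQueue q ω.1 ω.2 := by
  ext A hA
  rw [Measure.map_apply Measurable.of_discrete hA, slotLaw,
    Measure.prod_apply MeasurableSet.of_discrete, lintegral_fintype]
  change (∑ s, P.schedule q s • (arrivalLaw p).map (nextQueue q s)) A = _
  rw [Measure.finsetSum_apply]
  refine Finset.sum_congr rfl fun s _ => ?_
  rw [Measure.smul_apply, smul_eq_mul, mul_comm, Measure.map_apply Measurable.of_discrete hA,
    PMF.toMeasure_apply_singleton _ _ (measurableSet_singleton s)]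
  rfl

instance isMarkovKernel_queueKernel (p : Fin n → Fin n → PMF ℕ) (P : MaxWeight n) :
    IsMarkovKernel (queueKernel p P) :=
  ⟨fun q => by
    rw [queueKernel_eq_map_slotLaw]
    exact Measure.isProbabilityMeasure_map Measurable.of_discrete.aemeasurable⟩

theorem integral_queueKernel (p : Fin n → Fin n → PMF ℕ) (P : MaxWeight n) (q : QueueState n)
    (f : QueueState n → ℝ) :
    ∫ x, f x ∂queueKernel p P q = ∫ ω, f (nextQueue q ω.1 ω.2) ∂slotLaw p P q := by
  rw [queueKernel_eq_map_slotLaw, integral_map Measurable.of_discrete.aemeasurable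
    Measurable.of_discrete.aestronglyMeasurable]

theorem integral_slotLaw_arrival (p : Fin n → Fin n → PMF ℕ) (P : MaxWeight n) (q : QueueState n)
    (f : QueueState n → ℝ) : ∫ ω, f ω.2 ∂slotLaw p P q = ∫ a, f a ∂arrivalLaw p := by
  rw [slotLaw, integral_fun_snd]
  simp

theorem slotLaw_singleton_ne_zero {p : Fin n → Fin n → PMF ℕ} {P : MaxWeight n}
    {q : QueueState n} {s : Equiv.Perm (Fin n)} (hs : s ∈ (P.schedule q).support)
    {a : QueueState n} (ha : arrivalLaw p {a} ≠ 0) : slotLaw p P q {(s, a)} ≠ 0 := by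
  rw [← Set.singleton_prod_singleton, slotLaw, Measure.prod_prod,
    PMF.toMeasure_apply_singleton _ _ (measurableSet_singleton s)]
  exact mul_ne_zero hs ha

theorem queueKernel_nextQueue_ne_zero {p : Fin n → Fin n → PMF ℕ} {P : MaxWeight n}
    {q : QueueState n} {s : Equiv.Perm (Fin n)} (hs : s ∈ (P.schedule q).support)
    {a : QueueState n} (ha : arrivalLaw p {a} ≠ 0) :
    queueKernel p P q {nextQueue q s a} ≠ 0 := by
  rw [queueKernel_eq_map_slotLaw, Measure.map_apply Measurable.of_discrete .of_discrete]
  refine fun h => slotLaw_singleton_ne_zero hs ha (measure_mono_null ?_ h)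
  rintro _ rfl
  rfl

/-- The net arrivals `a - s` of a slot. -/
noncomputable def netArrival (ω : Equiv.Perm (Fin n) × QueueState n) : EuclMatrix (Fin n) (Fin n) :=
  queueVec ω.2 - schedVec ω.1

/-- The service wasted on empty queues in a slot that starts from the queue lengths `q`: the
correction `u` in `q⁺ = q + a - s + u`. -/
noncomputable def unusedService (q : QueueState n) (ω : Equiv.Perm (Fin n) × QueueState n) :
    EuclMatrix (Fin n) (Fin n) :=
  queueVec (nextQueue q ω.1 ω.2) - (queueVec q + netArrival ω)

theorem queueVec_nextQueue (q : QueueState n) (ω : Equiv.Perm (Fin n) × QueueState n) :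
    queueVec (nextQueue q ω.1 ω.2) = queueVec q + netArrival ω + unusedService q ω :=
  (add_sub_cancel _ _).symm

theorem unusedService_apply (q : QueueState n) (ω : Equiv.Perm (Fin n) × QueueState n)
    (i j : Fin n) :
    unusedService q ω (i, j) = if ω.1 i = j ∧ q i j + ω.2 i j = 0 then 1 else 0 := by
  simp only [unusedService, netArrival, PiLp.sub_apply, PiLp.add_apply, queueVec_apply,
    schedVec_apply, nextQueue]
  by_cases hs : ω.1 i = j
  · rcases Nat.eq_zero_or_pos (q i j + ω.2 i j) with h0 | hpos
    · obtain ⟨h1, h2⟩ := Nat.add_eq_zero_iff.1 h0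
      simp [hs, h1, h2]
    · simp only [hs, if_true, true_and, hpos.ne', if_false]
      push_cast [hpos]
      ring
  · simp [hs]

theorem unusedService_nonneg (q : QueueState n) (ω : Equiv.Perm (Fin n) × QueueState n)
    (i j : Fin n) : 0 ≤ unusedService q ω (i, j) := by
  rw [unusedService_apply]
  positivity

theorem inner_queueVec_nextQueue_unusedService (q : QueueState n)
    (ω : Equiv.Perm (Fin n) × QueueState n) :
    ⟪queueVec (nextQueue q ω.1 ω.2), unusedService q ω⟫ = 0 := by
  rw [inner_eq_sum]
  refine Finset.sum_eq_zero fun i _ => Finset.sum_eq_zero fun j _ => ?_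
  rw [unusedService_apply]
  split_ifs with h
  · simp [nextQueue, h.2]
  · rw [mul_zero]

theorem norm_unusedService_sq (q : QueueState n) (ω : Equiv.Perm (Fin n) × QueueState n) :
    ‖unusedService q ω‖ ^ 2 = ⟪vec 1, unusedService q ω⟫ := by
  rw [← real_inner_self_eq_norm_sq, inner_eq_sum, inner_eq_sum]
  refine Finset.sum_congr rfl fun i _ => Finset.sum_congr rfl fun j _ => ?_
  rw [unusedService_apply]
  split_ifs <;> simp

theorem norm_queueVec_nextQueue_sub_sq_le (q : QueueState n)
    (ω : Equiv.Perm (Fin n) × QueueState n) {y : EuclMatrix (Fin n) (Fin n)}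
    (hy : ∀ i j, 0 ≤ y (i, j)) :
    ‖queueVec (nextQueue q ω.1 ω.2) - y‖ ^ 2 ≤ ‖queueVec q - y + netArrival ω‖ ^ 2 := by
  have hyu : 0 ≤ ⟪y, unusedService q ω⟫ :=
    inner_nonneg_of_apply_nonneg hy (unusedService_nonneg q ω)
  have hsub : queueVec q - y + netArrival ω =
      queueVec (nextQueue q ω.1 ω.2) - y - unusedService q ω := by
    rw [queueVec_nextQueue]
    abel
  rw [hsub, norm_sub_sq_real (queueVec (nextQueue q ω.1 ω.2) - y), inner_sub_left,
    inner_queueVec_nextQueue_unusedService]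
  nlinarith [sq_nonneg ‖unusedService q ω‖]

/-- A bound on the norms of the net arrivals and of the queue length increments of a slot with at
most `amax` arrivals per queue. -/
def slotBound (n amax : ℕ) : ℝ := n * (amax + 1)

theorem slotBound_nonneg (n amax : ℕ) : 0 ≤ slotBound n amax := by
  unfold slotBound; positivity

theorem norm_netArrival_le {amax : ℕ} {ω : Equiv.Perm (Fin n) × QueueState n}
    (ha : ∀ i j, ω.2 i j ≤ amax) : ‖netArrival ω‖ ≤ slotBound n amax := by
  refine norm_le_of_abs_apply_le (by positivity) fun i j => ?_
  have hle : (ω.2 i j : ℝ) ≤ amax := Nat.cast_le.2 (ha i j)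
  simp only [netArrival, PiLp.sub_apply, queueVec_apply, schedVec_apply]
  rw [abs_le]
  split_ifs <;> constructor <;> linarith [(Nat.cast_nonneg (ω.2 i j) : (0 : ℝ) ≤ ω.2 i j)]

theorem norm_queueVec_nextQueue_sub_le {amax : ℕ} (q : QueueState n)
    {ω : Equiv.Perm (Fin n) × QueueState n} (ha : ∀ i j, ω.2 i j ≤ amax) :
    ‖queueVec (nextQueue q ω.1 ω.2) - queueVec q‖ ≤ slotBound n amax := by
  refine norm_le_of_abs_apply_le (by positivity) fun i j => ?_
  have hnat : nextQueue q ω.1 ω.2 i j ≤ q i j + amax ∧ q i j ≤ nextQueue q ω.1 ω.2 i j + 1 := by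
    have := ha i j
    simp only [nextQueue]
    split_ifs <;> omega
  have hup : (nextQueue q ω.1 ω.2 i j : ℝ) ≤ q i j + amax := by exact_mod_cast hnat.1
  have hlo : (q i j : ℝ) ≤ nextQueue q ω.1 ω.2 i j + 1 := by exact_mod_cast hnat.2
  simp only [PiLp.sub_apply, queueVec_apply]
  rw [abs_le]
  constructor <;> linarith [(Nat.cast_nonneg amax : (0 : ℝ) ≤ amax)]

namespace IsArrival

variable {p : Fin n → Fin n → PMF ℕ} {amax : ℕ} {lam : Fin n → Fin n → ℝ}

theorem ae_slotLaw (h : IsArrival amax lam p) (P : MaxWeight n) (q : QueueState n) :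
    ∀ᵐ ω ∂slotLaw p P q, ω.1 ∈ (P.schedule q).support ∧ ∀ i j, ω.2 i j ≤ amax :=
  (Measure.quasiMeasurePreserving_fst.ae (ae_toMeasure_mem_support (P.schedule q))).and
    (Measure.quasiMeasurePreserving_snd.ae h.ae_le)

theorem integrable_slotLaw (h : IsArrival amax lam p) (P : MaxWeight n) (q : QueueState n)
    (f : Equiv.Perm (Fin n) × QueueState n → ℝ) : Integrable f (slotLaw p P q) := by
  refine memLp_one_iff_integrable.1 (memLp_of_ae_mem_finite
    (Set.finite_univ.prod (finite_setOf_forall_le amax)) ?_ f 1)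
  filter_upwards [h.ae_slotLaw P q] with ω hω using ⟨Set.mem_univ _, hω.2⟩

theorem integrable_queueKernel (h : IsArrival amax lam p) (P : MaxWeight n) (q : QueueState n)
    (f : QueueState n → ℝ) : Integrable f (queueKernel p P q) := by
  rw [queueKernel_eq_map_slotLaw, integrable_map_measure
    Measurable.of_discrete.aestronglyMeasurable Measurable.of_discrete.aemeasurable]
  exact h.integrable_slotLaw P q _

theorem ae_norm_queueVec_sub_le (h : IsArrival amax lam p) (P : MaxWeight n) (q : QueueState n) :
    ∀ᵐ x ∂queueKernel p P q, ‖queueVec x - queueVec q‖ ≤ slotBound n amax := by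
  rw [queueKernel_eq_map_slotLaw, ae_map_iff Measurable.of_discrete.aemeasurable .of_discrete]
  filter_upwards [h.ae_slotLaw P q] with ω hω using norm_queueVec_nextQueue_sub_le q hω.2

theorem integral_slotLaw_inner_sub (h : IsArrival amax lam p) (P : MaxWeight n) (q : QueueState n)
    (c : EuclMatrix (Fin n) (Fin n)) :
    ∫ ω, ⟪c, queueVec ω.2 - vec lam⟫ ∂slotLaw p P q = 0 := by
  rw [integral_slotLaw_arrival p P q fun a => ⟪c, queueVec a - vec lam⟫]
  simp only [inner_sub_right]
  rw [integral_sub (h.integrable _) (integrable_const _), h.integral_inner, integral_const,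
    probReal_univ, one_smul, sub_self]

theorem integral_norm_queueVec_sub_sq_le (h : IsArrival amax lam p) {P : MaxWeight n}
    {q : QueueState n} {y : EuclMatrix (Fin n) (Fin n)} (hy : ∀ i j, 0 ≤ y (i, j)) {C : ℝ}
    (hC : ∀ s ∈ (P.schedule q).support, ⟪queueVec q - y, vec lam - schedVec s⟫ ≤ -C) :
    ∫ x, ‖queueVec x - y‖ ^ 2 ∂queueKernel p P q ≤
      ‖queueVec q - y‖ ^ 2 - 2 * C + slotBound n amax ^ 2 := by
  have hslot : ∀ᵐ ω ∂slotLaw p P q, ‖queueVec (nextQueue q ω.1 ω.2) - y‖ ^ 2 ≤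
      ‖queueVec q - y‖ ^ 2 - 2 * C + slotBound n amax ^ 2 +
        2 * ⟪queueVec q - y, queueVec ω.2 - vec lam⟫ := by
    filter_upwards [h.ae_slotLaw P q] with ω hω
    have hsplit : netArrival ω = queueVec ω.2 - vec lam + (vec lam - schedVec ω.1) :=
      (sub_add_sub_cancel ..).symm
    have hnorm := pow_le_pow_left₀ (norm_nonneg _) (norm_netArrival_le hω.2) 2
    have hle := norm_queueVec_nextQueue_sub_sq_le q ω hy
    rw [norm_add_sq_real] at hle
    nth_rw 1 [hsplit] at hle
    rw [inner_add_right] at hle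
    linarith [hC ω.1 hω.1]
  rw [integral_queueKernel p P q fun x => ‖queueVec x - y‖ ^ 2]
  refine (integral_mono_ae (h.integrable_slotLaw P q _) (h.integrable_slotLaw P q _)
    hslot).trans_eq ?_
  rw [integral_add (integrable_const _) (h.integrable_slotLaw P q _), integral_const_mul,
    h.integral_slotLaw_inner_sub]
  simp

end IsArrival

end Slot

section Stability

attribute [local instance] measurableSpacePerm

variable {n amax : ℕ} {lam : Fin n → Fin n → ℝ} {p : Fin n → Fin n → PMF ℕ} {P : MaxWeight n}
  {μ : Measure (QueueState n)}

/-- The load is below the capacity of each input and output port. -/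
def IsUnderloaded (lam : Fin n → Fin n → ℝ) : Prop :=
  (∀ i, ∑ j, lam i j < 1) ∧ ∀ j, ∑ i, lam i j < 1

theorem IsUnderloaded.exists_margin (hlam : IsUnderloaded lam) :
    ∃ c > 0, (∀ i, ∑ j, lam i j + n * c ≤ 1) ∧ ∀ j, ∑ i, lam i j + n * c ≤ 1 := by
  have hlim : ∀ r : ℝ, Tendsto (fun c : ℝ => r + n * c) (𝓝[>] 0) (𝓝 r) := fun r => by
    have h : Continuous fun c : ℝ => r + n * c := by fun_prop
    simpa using h.continuousWithinAt.tendsto (x := (0 : ℝ))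
  have hrow := eventually_all.2 fun i => (hlim _).eventually_le_const (hlam.1 i)
  have hcol := eventually_all.2 fun j => (hlim _).eventually_le_const (hlam.2 j)
  exact ((eventually_mem_nhdsWithin (a := (0 : ℝ))).and (hrow.and hcol)).exists

namespace IsArrival

theorem integral_norm_queueVec_sq_le (h : IsArrival amax lam p) {c : ℝ} (hc : 0 ≤ c)
    (hrow : ∀ i, ∑ j, lam i j + n * c ≤ 1) (hcol : ∀ j, ∑ i, lam i j + n * c ≤ 1)
    (q : QueueState n) :
    ∫ x, ‖queueVec x‖ ^ 2 ∂queueKernel p P q ≤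
      ‖queueVec q‖ ^ 2 - 2 * c * ‖queueVec q‖ + slotBound n amax ^ 2 := by
  have hdrift := h.integral_norm_queueVec_sub_sq_le (P := P) (q := q) (y := 0) (by simp)
    fun s hs => by
      rw [sub_zero]
      exact MaxWeight.inner_sub_schedVec_le_of_lt_one hs h.mean_nonneg hc hrow hcol
  simpa [mul_assoc] using hdrift

theorem exists_isSteadyState (h : IsArrival amax lam p) (hlam : IsUnderloaded lam)
    (P : MaxWeight n) : ∃ μ, IsSteadyState p P μ := by
  obtain ⟨c, hc, hrow, hcol⟩ := hlam.exists_margin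
  refine exists_invariant_of_drift (V := fun q => ENNReal.ofReal (‖queueVec q‖ ^ 2))
    (f := fun q => ENNReal.ofReal (2 * c * ‖queueVec q‖))
    (b := ENNReal.ofReal (slotBound n amax ^ 2)) 0 ENNReal.ofReal_ne_top ENNReal.ofReal_ne_top
    (fun R => ?_) fun q => ?_
  · obtain ⟨M, hM⟩ := exists_nat_ge ((R : ℝ) / (2 * c))
    refine (finite_setOf_forall_le M).subset fun q hq i j => ?_
    rw [Set.mem_ofPred_eq, ← ENNReal.ofReal_natCast,
      ENNReal.ofReal_lt_ofReal_iff_of_nonneg (by positivity)] at hq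
    have hnorm : ‖queueVec q‖ ≤ M := ((lt_div_iff₀' (by positivity)).2 hq).le.trans hM
    have hle : (q i j : ℝ) ≤ M :=
      (le_abs_self _).trans ((abs_apply_le_norm (queueVec q) i j).trans hnorm)
    exact_mod_cast hle
  · rw [← ofReal_integral_eq_lintegral_ofReal (h.integrable_queueKernel P q _)
        (ae_of_all _ fun _ => sq_nonneg _),
      ← ENNReal.ofReal_add (integral_nonneg fun _ => sq_nonneg _) (by positivity),
      ← ENNReal.ofReal_add (sq_nonneg _) (sq_nonneg _)]
    refine ENNReal.ofReal_le_ofReal ?_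
    linarith [h.integral_norm_queueVec_sq_le (P := P) hc.le hrow hcol q]

end IsArrival

theorem MaxWeight.exists_pos_of_mem_support {q : QueueState n} (hq : q ≠ 0)
    {s : Equiv.Perm (Fin n)} (hs : s ∈ (P.schedule q).support) : ∃ i, 0 < q i (s i) := by
  by_contra! hzero
  refine hq (funext fun i => funext fun j => Nat.le_zero.1 ?_)
  calc q i j = q i (Equiv.swap i j i) := by rw [Equiv.swap_apply_left]
    _ ≤ ∑ i', q i' (Equiv.swap i j i') :=
        Finset.single_le_sum (f := fun i' => q i' (Equiv.swap i j i')) (fun _ _ => Nat.zero_le _)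
          (Finset.mem_univ i)
    _ ≤ ∑ i', q i' (s i') := P.weight_le q s hs _
    _ ≤ 0 := Finset.sum_nonpos fun i' _ => hzero i'

theorem sum_nextQueue_zero_lt {q : QueueState n} {s : Equiv.Perm (Fin n)} {i : Fin n}
    (hi : 0 < q i (s i)) : ∑ i, ∑ j, nextQueue q s 0 i j < ∑ i, ∑ j, q i j := by
  have hle : ∀ i j, nextQueue q s 0 i j ≤ q i j := fun i j => by simp [nextQueue]
  have hlt : nextQueue q s 0 i (s i) < q i (s i) := by simp [nextQueue, hi]
  exact Finset.sum_lt_sum (fun i _ => Finset.sum_le_sum fun j _ => hle i j)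
    ⟨i, Finset.mem_univ i,
      Finset.sum_lt_sum (fun j _ => hle i j) ⟨s i, Finset.mem_univ _, hlt⟩⟩

-- In slots without arrivals MaxWeight serves at least one packet until all queues are empty.
theorem IsArrival.accessible_zero (h : IsArrival amax lam p) (hlt : ∀ i j, lam i j < 1)
    (P : MaxWeight n) (q : QueueState n) : Accessible (queueKernel p P) q 0 := by
  induction hN : ∑ i, ∑ j, q i j using Nat.strong_induction_on generalizing q with
  | _ N ih =>
    rcases eq_or_ne q 0 with rfl | hq
    · exact .refl
    · obtain ⟨s, hs⟩ := (P.schedule q).support_nonempty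
      obtain ⟨i, hi⟩ := MaxWeight.exists_pos_of_mem_support hq hs
      exact .head (queueKernel_nextQueue_ne_zero hs (h.arrivalLaw_zero_ne_zero hlt))
        (ih _ (hN ▸ sum_nextQueue_zero_lt hi) _ rfl)

theorem IsArrival.lt_one_of_isUnderloaded (h : IsArrival amax lam p) (hlam : IsUnderloaded lam)
    (i j : Fin n) : lam i j < 1 :=
  (Finset.single_le_sum (fun j' _ => h.mean_nonneg i j') (Finset.mem_univ j)).trans_lt (hlam.1 i)

theorem IsArrival.existsUnique_isSteadyState (h : IsArrival amax lam p)
    (hlam : IsUnderloaded lam) (P : MaxWeight n) : ∃! μ, IsSteadyState p P μ := by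
  obtain ⟨μ, hμ⟩ := h.exists_isSteadyState hlam P
  refine ⟨μ, hμ, fun ρ hρ => ?_⟩
  have := hμ.1
  have := hρ.1
  exact eq_of_invariant_of_accessible hρ.2 hμ.2
    (h.accessible_zero (h.lt_one_of_isUnderloaded hlam) P)

theorem IsArrival.integral_inner_queueVec_sub (h : IsArrival amax lam p)
    {w : EuclMatrix (Fin n) (Fin n)} {r : ℝ} (hws : ∀ s, ⟪w, schedVec s⟫ = r)
    (q : QueueState n) :
    ∫ x, ⟪w, queueVec x⟫ ∂queueKernel p P q - ⟪w, queueVec q⟫ =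
      ⟪w, vec lam⟫ - r + ∫ ω, ⟪w, unusedService q ω⟫ ∂slotLaw p P q := by
  have hstep : ∀ ω, ⟪w, queueVec (nextQueue q ω.1 ω.2)⟫ =
      ⟪w, queueVec q⟫ - r + ⟪w, queueVec ω.2⟫ + ⟪w, unusedService q ω⟫ := fun ω => by
    rw [queueVec_nextQueue, netArrival, inner_add_right, inner_add_right, inner_sub_right, hws]
    ring
  rw [integral_queueKernel p P q fun x => ⟪w, queueVec x⟫]
  simp only [hstep]
  rw [integral_add (h.integrable_slotLaw P q _) (h.integrable_slotLaw P q _),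
    integral_add (integrable_const _) (h.integrable_slotLaw P q _),
    integral_slotLaw_arrival p P q fun a => ⟪w, queueVec a⟫, h.integral_inner, integral_const,
    probReal_univ, one_smul]
  ring

namespace IsSteadyState

theorem integrable_norm_queueVec_sq (hμ : IsSteadyState p P μ) (h : IsArrival amax lam p)
    (hlam : IsUnderloaded lam) : Integrable (fun q => ‖queueVec q‖ ^ 2) μ := by
  have := hμ.1
  obtain ⟨c, hc, hrow, hcol⟩ := hlam.exists_margin
  refine (integrable_sq_of_drift hμ.2 hc (slotBound_nonneg n amax) .of_discrete
    (fun q => norm_nonneg _) (fun q => ?_)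
    (h.integral_norm_queueVec_sq_le hc.le hrow hcol)).1
  filter_upwards [h.ae_norm_queueVec_sub_le P q] with x hx
    using (abs_norm_sub_norm_le _ _).trans hx

theorem measure_singleton_zero_ne_zero (hμ : IsSteadyState p P μ) (h : IsArrival amax lam p)
    (hlt : ∀ i j, lam i j < 1) : μ {0} ≠ 0 := fun h0 =>
  have := hμ.1
  IsProbabilityMeasure.ne_zero μ
    (eq_zero_of_invariant_of_accessible hμ.2 (h.accessible_zero hlt P) h0)

-- In steady state the mean of `⟪w, q⟫` does not drift, so that the mean unused service makes up for
-- the difference between service and arrivals.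
theorem integral_inner_unusedService (hμ : IsSteadyState p P μ) (h : IsArrival amax lam p)
    {w : EuclMatrix (Fin n) (Fin n)} (hw : ∀ i j, 0 ≤ w (i, j)) {r : ℝ}
    (hws : ∀ s, ⟪w, schedVec s⟫ = r) :
    Integrable (fun q => ∫ ω, ⟪w, unusedService q ω⟫ ∂slotLaw p P q) μ ∧
      ∫ q, ∫ ω, ⟪w, unusedService q ω⟫ ∂slotLaw p P q ∂μ = r - ⟪w, vec lam⟫ := by
  have := hμ.1
  have hB : 0 ≤ ‖w‖ * slotBound n amax := mul_nonneg (norm_nonneg _) (slotBound_nonneg n amax)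
  have hinc : ∀ q, ∀ᵐ x ∂queueKernel p P q,
      |⟪w, queueVec x⟫ - ⟪w, queueVec q⟫| ≤ ‖w‖ * slotBound n amax := fun q => by
    filter_upwards [h.ae_norm_queueVec_sub_le P q] with x hx
    rw [← inner_sub_right]
    exact (abs_real_inner_le_norm _ _).trans (mul_le_mul_of_nonneg_left hx (norm_nonneg _))
  have hdrift : Integrable
      (fun q => ∫ x, ⟪w, queueVec x⟫ ∂queueKernel p P q - ⟪w, queueVec q⟫) μ :=
    .of_bound Measurable.of_discrete.aestronglyMeasurable _ <| ae_of_all _ fun q =>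
      abs_integral_sub_le_of_abs_sub_le (h.integrable_queueKernel P q _) (hinc q)
  have hzero := integral_drift_eq_zero hμ.2 (F := fun q => ⟪w, queueVec q⟫) hB .of_discrete
    (fun q => inner_nonneg_of_apply_nonneg hw fun i j => Nat.cast_nonneg _) hinc
  have hunused : ∀ q, ∫ ω, ⟪w, unusedService q ω⟫ ∂slotLaw p P q =
      (∫ x, ⟪w, queueVec x⟫ ∂queueKernel p P q - ⟪w, queueVec q⟫) + (r - ⟪w, vec lam⟫) :=
    fun q => by rw [h.integral_inner_queueVec_sub hws]; ring
  simp only [hunused]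
  refine ⟨hdrift.add (integrable_const _), ?_⟩
  rw [integral_add hdrift (integrable_const _), hzero]
  simp

theorem inner_le (hμ : IsSteadyState p P μ) (h : IsArrival amax lam p)
    {w : EuclMatrix (Fin n) (Fin n)} (hw : ∀ i j, 0 ≤ w (i, j)) {r : ℝ}
    (hws : ∀ s, ⟪w, schedVec s⟫ = r) : ⟪w, vec lam⟫ ≤ r := by
  rw [← sub_nonneg, ← (hμ.integral_inner_unusedService h hw hws).2]
  exact integral_nonneg fun q => integral_nonneg fun ω =>
    inner_nonneg_of_apply_nonneg hw (unusedService_nonneg q ω)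

theorem inner_lt (hμ : IsSteadyState p P μ) (h : IsArrival amax lam p)
    (hlt : ∀ i j, lam i j < 1) {w : EuclMatrix (Fin n) (Fin n)} (hw : ∀ i j, 0 ≤ w (i, j))
    {r : ℝ} (hr : 0 < r) (hws : ∀ s, ⟪w, schedVec s⟫ = r) : ⟪w, vec lam⟫ < r := by
  obtain ⟨hint, heq⟩ := hμ.integral_inner_unusedService h hw hws
  have hnn : ∀ q ω, 0 ≤ ⟪w, unusedService q ω⟫ := fun q ω =>
    inner_nonneg_of_apply_nonneg hw (unusedService_nonneg q ω)
  obtain ⟨s, hs⟩ := (P.schedule (0 : QueueState n)).support_nonempty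
  have hunused : unusedService 0 (s, 0) = schedVec s := by
    ext ⟨i, j⟩
    simp [unusedService_apply]
  have hslot := slotLaw_singleton_ne_zero hs (h.arrivalLaw_zero_ne_zero hlt)
  have hpos : 0 < ∫ ω, ⟪w, unusedService 0 ω⟫ ∂slotLaw p P 0 := by
    rw [integral_pos_iff_support_of_nonneg (hnn 0) (h.integrable_slotLaw P 0 _)]
    refine (pos_iff_ne_zero.2 hslot).trans_le (measure_mono (Set.singleton_subset_iff.2 ?_))
    rw [Function.mem_support, hunused, hws]
    exact hr.ne'
  rw [← sub_pos, ← heq, integral_pos_iff_support_of_nonneg (fun q => integral_nonneg (hnn q)) hint]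
  exact (pos_iff_ne_zero.2 (hμ.measure_singleton_zero_ne_zero h hlt)).trans_le
    (measure_mono (Set.singleton_subset_iff.2 hpos.ne'))

theorem sum_row_le_one (hμ : IsSteadyState p P μ) (h : IsArrival amax lam p) (i : Fin n) :
    ∑ j, lam i j ≤ 1 := by
  simpa using hμ.inner_le h (fun i' j => (rowVec_mem_collapseCone i).2 (i', j)) fun s => by
    rw [inner_rowVec, sum_schedVec_row]

theorem isUnderloaded (hμ : IsSteadyState p P μ) (h : IsArrival amax lam p)
    (hlt : ∀ i j, lam i j < 1) : IsUnderloaded lam := by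
  refine ⟨fun i => ?_, fun j => ?_⟩
  · simpa using hμ.inner_lt h hlt (fun i' j => (rowVec_mem_collapseCone i).2 (i', j)) one_pos
      fun s => by rw [inner_rowVec, sum_schedVec_row]
  · simpa using hμ.inner_lt h hlt (fun i j' => (colVec_mem_collapseCone j).2 (i, j')) one_pos
      fun s => by rw [inner_colVec, sum_schedVec_col]

end IsSteadyState

end Stability

section ProjectedDrift

theorem abs_norm_starProjection_sq_sub_le {E : Type*} [NormedAddCommGroup E]
    [InnerProductSpace ℝ E] (K : Submodule ℝ E) [K.HasOrthogonalProjection] {x u : E}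
    (hxu : ⟪x, u⟫ = 0) {η : ℝ} (hη : 0 < η) :
    |‖K.starProjection x‖ ^ 2 - ‖K.starProjection (x - u)‖ ^ 2| ≤
      η * ‖x - K.starProjection x‖ ^ 2 + (1 / η + 1) * ‖u‖ ^ 2 := by
  have hcross : ⟪K.starProjection x, K.starProjection u⟫ = -⟪x - K.starProjection x, u⟫ := by
    rw [← Submodule.inner_starProjection_left_eq_right,
      Submodule.starProjection_eq_self_iff.2 (Submodule.starProjection_apply_mem _ x),
      inner_sub_left, hxu]
    ring
  have hcontr : ‖K.starProjection u‖ ^ 2 ≤ ‖u‖ ^ 2 :=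
    pow_le_pow_left₀ (norm_nonneg _) (K.norm_starProjection_apply_le u) 2
  have hamgm : 2 * |⟪x - K.starProjection x, u⟫| ≤
      η * ‖x - K.starProjection x‖ ^ 2 + 1 / η * ‖u‖ ^ 2 := by
    have hsq : 0 ≤ 1 / η * (η * ‖x - K.starProjection x‖ - ‖u‖) ^ 2 := by positivity
    have hexpand : 1 / η * (η * ‖x - K.starProjection x‖ - ‖u‖) ^ 2 =
        η * ‖x - K.starProjection x‖ ^ 2 - 2 * (‖x - K.starProjection x‖ * ‖u‖) +
          1 / η * ‖u‖ ^ 2 := by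
      field_simp
      ring
    linarith [abs_real_inner_le_norm (x - K.starProjection x) u]
  rw [map_sub, norm_sub_sq_real, hcross, abs_le]
  constructor <;>
    nlinarith [neg_abs_le ⟪x - K.starProjection x, u⟫, le_abs_self ⟪x - K.starProjection x, u⟫,
      sq_nonneg ‖K.starProjection u‖]

attribute [local instance] measurableSpacePerm

variable {n amax : ℕ} {lam ν k : Fin n → Fin n → ℝ} {ε : ℝ} {p : Fin n → Fin n → PMF ℕ}
  {P : MaxWeight n} {μ : Measure (QueueState n)}

local notation "π" => Submodule.starProjection (collapseSpace (Fin n) (Fin n))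

theorem vec_sub_mul (ν k : Fin n → Fin n → ℝ) (ε : ℝ) :
    (vec fun i j => ν i j - ε * k i j) = vec ν - ε • vec k := rfl

theorem starProjection_vec_sub_schedVec (hν : ν ∈ saturatedFace n n n)
    (s : Equiv.Perm (Fin n)) :
    π ((vec fun i j => ν i j - ε * k i j) - schedVec s) = -(ε • π (vec k)) := by
  rw [vec_sub_mul, sub_right_comm, map_sub, map_smul,
    (Submodule.starProjection_apply_eq_zero_iff _).2 (vec_sub_schedVec_mem_orthogonal hν s),
    zero_sub]

namespace IsArrival

-- The row sums, the column sums and the total of the centred arrivals have variances adding up to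
-- `n⁻¹ V`, `n⁻¹ V` and `n⁻² V`, where `V` is the sum of the entrywise variances.
theorem integral_norm_starProjection_sub_sq [NeZero n] (h : IsArrival amax lam p) :
    ∫ a, ‖π (queueVec a - vec lam)‖ ^ 2 ∂arrivalLaw p =
      (2 / n - 1 / n ^ 2) * ∑ i, ∑ j, arrivalVar p i j := by
  have hrow : ∀ i, ∫ a, ⟪rowVec (Fin n) i, queueVec a - vec lam⟫ ^ 2 ∂arrivalLaw p =
      ∑ j, arrivalVar p i j := fun i => by
    rw [h.integral_inner_sub_sq]
    simp [rowVec]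
  have hcol : ∀ j, ∫ a, ⟪colVec (Fin n) j, queueVec a - vec lam⟫ ^ 2 ∂arrivalLaw p =
      ∑ i, arrivalVar p i j := fun j => by
    rw [h.integral_inner_sub_sq]
    simp [colVec]
  have htotal : ∫ a, ⟪vec 1, queueVec a - vec lam⟫ ^ 2 ∂arrivalLaw p =
      ∑ i, ∑ j, arrivalVar p i j := by
    rw [h.integral_inner_sub_sq]
    simp
  have hpoint : ∀ a, ‖π (queueVec a - vec lam)‖ ^ 2 =
      (∑ i, ⟪rowVec (Fin n) i, queueVec a - vec lam⟫ ^ 2) / n +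
        (∑ j, ⟪colVec (Fin n) j, queueVec a - vec lam⟫ ^ 2) / n -
          ⟪vec 1, queueVec a - vec lam⟫ ^ 2 / n ^ 2 := fun a => by
    rw [norm_starProjection_collapseSpace_sq]
    simp [inner_eq_sum (vec 1), sq]
  simp only [hpoint]
  rw [integral_sub (h.integrable _) (h.integrable _),
    integral_add (h.integrable _) (h.integrable _), integral_div, integral_div, integral_div,
    integral_finsetSum _ fun i _ => h.integrable _, integral_finsetSum _ fun j _ => h.integrable _]
  simp only [hrow, hcol, htotal]
  rw [Finset.sum_comm (f := fun j i => arrivalVar p i j)]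
  ring

theorem integral_norm_starProjection_add_netArrival_sq [NeZero n]
    (h : IsArrival amax (fun i j => ν i j - ε * k i j) p) (hν : ν ∈ saturatedFace n n n)
    (P : MaxWeight n) (q : QueueState n) :
    ∫ ω, ‖π (queueVec q + netArrival ω)‖ ^ 2 ∂slotLaw p P q =
      ‖π (queueVec q)‖ ^ 2 - 2 * ε * ⟪π (queueVec q), vec k⟫ + ε ^ 2 * ‖π (vec k)‖ ^ 2 +
        (2 / n - 1 / n ^ 2) * ∑ i, ∑ j, arrivalVar p i j := by
  set lam : Fin n → Fin n → ℝ := fun i j => ν i j - ε * k i j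
  set y : EuclMatrix (Fin n) (Fin n) := π (queueVec q) - ε • π (vec k) with hy
  have hpoint : ∀ ω : Equiv.Perm (Fin n) × QueueState n,
      ‖π (queueVec q + netArrival ω)‖ ^ 2 =
        ‖y‖ ^ 2 + 2 * ⟪π y, queueVec ω.2 - vec lam⟫ + ‖π (queueVec ω.2 - vec lam)‖ ^ 2 := by
    intro ω
    have hsplit : π (queueVec q + netArrival ω) = y + π (queueVec ω.2 - vec lam) := by
      rw [netArrival, ← sub_add_sub_cancel (queueVec ω.2) (vec lam), map_add, map_add,
        starProjection_vec_sub_schedVec hν, hy]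
      abel
    rw [hsplit, norm_add_sq_real, Submodule.inner_starProjection_left_eq_right]
  have hnorm : ‖y‖ ^ 2 =
      ‖π (queueVec q)‖ ^ 2 - 2 * ε * ⟪π (queueVec q), vec k⟫ + ε ^ 2 * ‖π (vec k)‖ ^ 2 := by
    rw [hy, norm_sub_sq_real, real_inner_smul_right, ← Submodule.inner_starProjection_left_eq_right,
      Submodule.starProjection_eq_self_iff.2 (Submodule.starProjection_apply_mem _ _), norm_smul,
      mul_pow, Real.norm_eq_abs, sq_abs]
    ring
  simp only [hpoint]
  rw [integral_add (h.integrable_slotLaw P q _) (h.integrable_slotLaw P q _),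
    integral_add (integrable_const _) (h.integrable_slotLaw P q _), integral_const_mul,
    h.integral_slotLaw_inner_sub,
    integral_slotLaw_arrival p P q fun a => ‖π (queueVec a - vec lam)‖ ^ 2,
    h.integral_norm_starProjection_sub_sq, hnorm]
  simp

theorem abs_integral_norm_starProjection_sq_sub_le (h : IsArrival amax lam p) (P : MaxWeight n)
    (q : QueueState n) {η : ℝ} (hη : 0 < η) :
    |∫ x, ‖π (queueVec x)‖ ^ 2 ∂queueKernel p P q -
        ∫ ω, ‖π (queueVec q + netArrival ω)‖ ^ 2 ∂slotLaw p P q| ≤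
      η * ∫ x, collapseDist (queueVec x) ^ 2 ∂queueKernel p P q +
        (1 / η + 1) * ∫ ω, ⟪vec 1, unusedService q ω⟫ ∂slotLaw p P q := by
  rw [integral_queueKernel p P q fun x => ‖π (queueVec x)‖ ^ 2,
    integral_queueKernel p P q fun x => collapseDist (queueVec x) ^ 2,
    ← integral_sub (h.integrable_slotLaw P q _) (h.integrable_slotLaw P q _),
    ← integral_const_mul, ← integral_const_mul,
    ← integral_add (h.integrable_slotLaw P q _) (h.integrable_slotLaw P q _)]
  refine abs_integral_le_integral_abs.trans
    (integral_mono (h.integrable_slotLaw P q _) (h.integrable_slotLaw P q _) fun ω => ?_)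
  have hdist := pow_le_pow_left₀ (norm_nonneg _)
    (norm_sub_starProjection_le_collapseDist (queueVec (nextQueue q ω.1 ω.2))) 2
  have hstep := abs_norm_starProjection_sq_sub_le (collapseSpace (Fin n) (Fin n))
    (inner_queueVec_nextQueue_unusedService q ω) hη
  rw [queueVec_nextQueue q ω, add_sub_cancel_right, ← queueVec_nextQueue q ω,
    norm_unusedService_sq] at hstep
  exact hstep.trans (by gcongr)

end IsArrival

end ProjectedDrift

section SteadyState

attribute [local instance] measurableSpacePerm

variable {n amax : ℕ} {ν k α : Fin n → Fin n → ℝ} {ε m : ℝ} {p : Fin n → Fin n → PMF ℕ}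
  {P : MaxWeight n} {μ : Measure (QueueState n)}

local notation "π" => Submodule.starProjection (collapseSpace (Fin n) (Fin n))

theorem half_le_sub_mul (hε : 0 ≤ ε) (hνm : ∀ i j, m ≤ ν i j) (hεk : ε * euclNorm k ≤ m / 2)
    (i j : Fin n) : m / 2 ≤ ν i j - ε * k i j := by
  have hk : k i j ≤ euclNorm k :=
    (le_abs_self _).trans ((abs_apply_le_norm (vec k) i j).trans_eq (norm_vec k))
  linarith [hνm i j, mul_le_mul_of_nonneg_left hk hε]

theorem weightedSum_eq_inner (α : Fin n → Fin n → ℝ) (q : QueueState n) :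
    weightedSum α q = ⟪queueVec q, vec α⟫ := by
  rw [inner_eq_sum]
  rfl

namespace IsSteadyState

-- State-space collapse: the bound does not depend on `ε`.
theorem integrable_collapseDist_sq (hμ : IsSteadyState p P μ)
    (h : IsArrival amax (fun i j => ν i j - ε * k i j) p) (hν : ν ∈ saturatedFace n n n)
    (hm : 0 < m) (hνm : ∀ i j, m ≤ ν i j) (hε : 0 ≤ ε) (hεk : ε * euclNorm k ≤ m / 2) :
    Integrable (fun q => collapseDist (queueVec q) ^ 2) μ ∧
      ∫ q, collapseDist (queueVec q) ^ 2 ∂μ ≤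
        momentBound (m / 2) (slotBound n amax ^ 2) (slotBound n amax) := by
  have := hμ.1
  refine integrable_sq_of_drift hμ.2 (half_pos hm) (slotBound_nonneg n amax) .of_discrete
    (fun q => collapseDist_nonneg _) (fun q => ?_) fun q => ?_
  · filter_upwards [h.ae_norm_queueVec_sub_le P q] with x hx
      using (abs_collapseDist_sub_le _ _).trans hx
  · obtain ⟨y, hy, hnorm, hdrift⟩ :=
      MaxWeight.exists_mem_collapseCone_inner_sub_le (P := P) hν hm.le hνm q
    have hk : -(ε * ⟪queueVec q - y, vec k⟫) ≤ m / 2 * collapseDist (queueVec q) := by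
      have hcs := neg_le_of_abs_le (abs_real_inner_le_norm (queueVec q - y) (vec k))
      rw [hnorm, norm_vec] at hcs
      nlinarith [mul_le_mul_of_nonneg_left hcs hε,
        mul_le_mul_of_nonneg_left hεk (collapseDist_nonneg (queueVec q))]
    refine (integral_mono (h.integrable_queueKernel P q _) (h.integrable_queueKernel P q _)
      fun x => pow_le_pow_left₀ (collapseDist_nonneg _) (collapseDist_le_norm_sub hy) 2).trans ?_
    refine (h.integral_norm_queueVec_sub_sq_le (fun i j => hy.2 (i, j))
      (C := m / 2 * collapseDist (queueVec q)) fun s hs => ?_).trans_eq (by rw [hnorm]; ring)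
    rw [vec_sub_mul, sub_right_comm, inner_sub_right, real_inner_smul_right]
    linarith [hdrift s hs]

theorem lt_one (hμ : IsSteadyState p P μ)
    (h : IsArrival amax (fun i j => ν i j - ε * k i j) p) (hν : ν ∈ saturatedFace n n n)
    (hm : 0 < m) (hνm : ∀ i j, m ≤ ν i j) (hk : k ≠ 0) (hε : 0 < ε)
    (hεk : ε * euclNorm k ≤ m / 2) (i j : Fin n) : ν i j - ε * k i j < 1 := by
  by_contra! hge
  have hrow := hμ.sum_row_le_one h i
  have hpos := half_le_sub_mul hε.le hνm hεk
  have hsub : ∀ j', j' = j := fun j' => by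
    by_contra hne
    have hpair := Finset.add_le_sum (fun j' _ => h.mean_nonneg i j') (Finset.mem_univ j)
      (Finset.mem_univ j') (Ne.symm hne)
    linarith [hpos i j']
  have : Unique (Fin n) := ⟨⟨j⟩, hsub⟩
  have hνij := hν.2.1 i i.2
  rw [Fintype.sum_subsingleton _ j] at hνij hrow
  refine hk (funext fun i' => funext fun j' => ?_)
  obtain rfl : i' = i := Subsingleton.elim _ _
  obtain rfl := hsub j'
  have hzero : ε * k i' j' = 0 := by linarith
  exact (mul_eq_zero.1 hzero).resolve_left hε.ne'

theorem integral_total_unusedService (hμ : IsSteadyState p P μ)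
    (h : IsArrival amax (fun i j => ν i j - ε * k i j) p) (hν : ν ∈ saturatedFace n n n) :
    Integrable (fun q => ∫ ω, ⟪vec 1, unusedService q ω⟫ ∂slotLaw p P q) μ ∧
      ∫ q, ∫ ω, ⟪vec 1, unusedService q ω⟫ ∂slotLaw p P q ∂μ = ε * ∑ i, ∑ j, k i j := by
  have htotal : ∀ x : EuclMatrix (Fin n) (Fin n), ⟪vec 1, x⟫ = ∑ i, ∑ j, x (i, j) := fun x => by
    simp [inner_eq_sum]
  have hsched : ∀ s : Equiv.Perm (Fin n), ⟪vec 1, schedVec s⟫ = n := fun s => by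
    simp only [htotal, sum_schedVec_row, Finset.sum_const, Finset.card_univ, Fintype.card_fin,
      nsmul_eq_mul, mul_one]
  obtain ⟨hint, heq⟩ := hμ.integral_inner_unusedService h (w := vec 1)
    (fun _ _ => zero_le_one) hsched
  refine ⟨hint, heq.trans ?_⟩
  simp [htotal, fun i => hν.2.1 i i.2, Finset.mul_sum]

theorem integrable_norm_starProjection_sq (hμ : IsSteadyState p P μ) {lam : Fin n → Fin n → ℝ}
    (h : IsArrival amax lam p) (hlam : IsUnderloaded lam) :
    Integrable (fun q => ‖π (queueVec q)‖ ^ 2) μ := by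
  refine (hμ.integrable_norm_queueVec_sq h hlam).mono' .of_discrete (ae_of_all _ fun q => ?_)
  rw [Real.norm_of_nonneg (sq_nonneg _)]
  exact pow_le_pow_left₀ (norm_nonneg _) (Submodule.norm_starProjection_apply_le _ _) 2

theorem integrable_queueVec (hμ : IsSteadyState p P μ) {lam : Fin n → Fin n → ℝ}
    (h : IsArrival amax lam p) (hlam : IsUnderloaded lam) : Integrable queueVec μ :=
  have := hμ.1
  ((memLp_two_iff_integrable_sq_norm .of_discrete).2
    (hμ.integrable_norm_queueVec_sq h hlam)).integrable one_le_two

-- The law of `‖π q‖ ^ 2` is stationary, and the unused service is an error term.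
theorem abs_two_mul_integral_inner_sub_le [NeZero n] (hμ : IsSteadyState p P μ)
    (h : IsArrival amax (fun i j => ν i j - ε * k i j) p) (hν : ν ∈ saturatedFace n n n)
    (hlam : IsUnderloaded fun i j => ν i j - ε * k i j)
    (hd : Integrable (fun q => collapseDist (queueVec q) ^ 2) μ) {η : ℝ} (hη : 0 < η) :
    |2 * ε * ∫ q, ⟪π (queueVec q), vec k⟫ ∂μ - (ε ^ 2 * ‖π (vec k)‖ ^ 2 +
        (2 / n - 1 / n ^ 2) * ∑ i, ∑ j, arrivalVar p i j)| ≤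
      η * ∫ q, collapseDist (queueVec q) ^ 2 ∂μ + (1 / η + 1) * (ε * ∑ i, ∑ j, k i j) := by
  have := hμ.1
  set W : ℝ := ε ^ 2 * ‖π (vec k)‖ ^ 2 + (2 / n - 1 / n ^ 2) * ∑ i, ∑ j, arrivalVar p i j with hW
  have hπ := hμ.integrable_norm_starProjection_sq h hlam
  have hinner : Integrable (fun q => ⟪π (queueVec q), vec k⟫) μ :=
    ((π).integrable_comp (hμ.integrable_queueVec h hlam)).inner_const (vec k)
  obtain ⟨hκπ, hκπ_eq⟩ := integral_integral_of_invariant hμ.2 hπ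
  obtain ⟨hκd, hκd_eq⟩ := integral_integral_of_invariant hμ.2 hd
  obtain ⟨hu, hu_eq⟩ := hμ.integral_total_unusedService h hν
  have hdrift : ∫ q, (∫ x, ‖π (queueVec x)‖ ^ 2 ∂queueKernel p P q -
      ∫ ω, ‖π (queueVec q + netArrival ω)‖ ^ 2 ∂slotLaw p P q) ∂μ =
        2 * ε * ∫ q, ⟪π (queueVec q), vec k⟫ ∂μ - W := by
    have hrw : ∀ q, ∫ x, ‖π (queueVec x)‖ ^ 2 ∂queueKernel p P q -
        ∫ ω, ‖π (queueVec q + netArrival ω)‖ ^ 2 ∂slotLaw p P q =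
          ∫ x, ‖π (queueVec x)‖ ^ 2 ∂queueKernel p P q - ‖π (queueVec q)‖ ^ 2 +
            (2 * ε * ⟪π (queueVec q), vec k⟫ - W) := fun q => by
      rw [h.integral_norm_starProjection_add_netArrival_sq hν P q, hW]
      ring
    have hincr : Integrable (fun q => ∫ x, ‖π (queueVec x)‖ ^ 2 ∂queueKernel p P q -
        ‖π (queueVec q)‖ ^ 2) μ := hκπ.sub hπ
    have hlin : Integrable (fun q => 2 * ε * ⟪π (queueVec q), vec k⟫ - W) μ :=
      (hinner.const_mul _).sub (integrable_const _)
    simp only [hrw]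
    rw [integral_add hincr hlin, integral_sub hκπ hπ, hκπ_eq, sub_self, zero_add,
      integral_sub (hinner.const_mul _) (integrable_const _), integral_const_mul, integral_const,
      probReal_univ, one_smul]
  rw [← hdrift, ← hκd_eq, ← hu_eq, ← integral_const_mul, ← integral_const_mul,
    ← integral_add (hκd.const_mul _) (hu.const_mul _)]
  have hbound : Integrable (fun q => η * ∫ x, collapseDist (queueVec x) ^ 2 ∂queueKernel p P q +
      (1 / η + 1) * ∫ ω, ⟪vec 1, unusedService q ω⟫ ∂slotLaw p P q) μ :=
    (hκd.const_mul _).add (hu.const_mul _)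
  rw [← Real.norm_eq_abs]
  exact norm_integral_le_of_norm_le hbound
    (ae_of_all _ fun q => h.abs_integral_norm_starProjection_sq_sub_le P q hη)

theorem integrable_weightedSum (hμ : IsSteadyState p P μ) {lam : Fin n → Fin n → ℝ}
    (h : IsArrival amax lam p) (hlam : IsUnderloaded lam) (α : Fin n → Fin n → ℝ) :
    Integrable (weightedSum α) μ :=
  ((hμ.integrable_queueVec h hlam).inner_const (vec α)).congr
    (ae_of_all _ fun q => (weightedSum_eq_inner α q).symm)

theorem abs_integral_weightedSum_sub_le (hμ : IsSteadyState p P μ) {lam : Fin n → Fin n → ℝ}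
    (h : IsArrival amax lam p) (hlam : IsUnderloaded lam) {M : ℝ}
    (hd : Integrable (fun q => collapseDist (queueVec q) ^ 2) μ)
    (hdM : ∫ q, collapseDist (queueVec q) ^ 2 ∂μ ≤ M)
    {c : ℝ} (hα : π (vec α) = c • π (vec k)) :
    |∫ q, weightedSum α q ∂μ - c * ∫ q, ⟪π (queueVec q), vec k⟫ ∂μ| ≤ (1 + M) * ‖vec α‖ := by
  have := hμ.1
  have hinner : Integrable (fun q => ⟪π (queueVec q), vec k⟫) μ :=
    ((π).integrable_comp (hμ.integrable_queueVec h hlam)).inner_const (vec k)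
  have hpoint : ∀ q, ‖weightedSum α q - c * ⟪π (queueVec q), vec k⟫‖ ≤
      (1 + collapseDist (queueVec q) ^ 2) * ‖vec α‖ := fun q => by
    have hsplit : weightedSum α q - c * ⟪π (queueVec q), vec k⟫ =
        ⟪queueVec q - π (queueVec q), vec α⟫ := by
      rw [inner_sub_left, Submodule.inner_starProjection_left_eq_right _ _ (vec α), hα,
        real_inner_smul_right, Submodule.inner_starProjection_left_eq_right, weightedSum_eq_inner]
    rw [hsplit]
    refine (abs_real_inner_le_norm _ _).trans (mul_le_mul_of_nonneg_right ?_ (norm_nonneg _))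
    refine (norm_sub_starProjection_le_collapseDist _).trans ?_
    nlinarith [sq_nonneg (collapseDist (queueVec q) - 1), collapseDist_nonneg (queueVec q)]
  have hone : Integrable (fun q => 1 + collapseDist (queueVec q) ^ 2) μ :=
    (integrable_const 1).add hd
  rw [← integral_const_mul, ← integral_sub (hμ.integrable_weightedSum h hlam α)
    (hinner.const_mul c)]
  refine (norm_integral_le_of_norm_le (hone.mul_const _) (ae_of_all _ hpoint)).trans ?_
  rw [integral_mul_const, integral_add (integrable_const 1) hd]
  refine mul_le_mul_of_nonneg_right ?_ (norm_nonneg _)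
  simpa using hdM

end IsSteadyState

theorem starProjection_vec_eq_smul {c : ℝ} (hrow : ∀ i, ∑ j, α i j = c * ∑ j, k i j)
    (hcol : ∀ j, ∑ i, α i j = c * ∑ i, k i j) : π (vec α) = c • π (vec k) := by
  rw [← map_smul, ← sub_eq_zero, ← map_sub, Submodule.starProjection_apply_eq_zero_iff]
  refine mem_orthogonal_collapseSpace (fun i => ?_) fun j => ?_
  · simp [hrow, Finset.mul_sum]
  · simp [hcol, Finset.mul_sum]

/-- The bound on the second moment of `collapseDist` in steady state: the drift towards the cone is
at least half of the smallest entry of `ν`. -/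
noncomputable def collapseBound (ν : Fin n → Fin n → ℝ) (amax : ℕ) : ℝ :=
  momentBound (minEntry ν / 2) (slotBound n amax ^ 2) (slotBound n amax)

/-- The error `B(ε)` in the two-sided bound on the mean weighted queue length. The collapse error
contributes the first summand; the second one is the effect of the unused service on the drift of
the projected queue lengths, with Young's inequality weighted by `√ε`. -/
noncomputable def errorBound (ν k α : Fin n → Fin n → ℝ) (amax : ℕ) (ε : ℝ) : ℝ :=
  (1 + collapseBound ν amax) * ‖vec α‖ + n / (2 * ε) * (ε ^ 2 * ‖π (vec k)‖ ^ 2 +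
    (√ε * collapseBound ν amax + (1 / √ε + 1) * (ε * ∑ i, ∑ j, k i j)))

theorem tendsto_mul_errorBound (ν k α : Fin n → Fin n → ℝ) (amax : ℕ) :
    Tendsto (fun ε => ε * errorBound ν k α amax ε) (𝓝[>] 0) (𝓝 0) := by
  have hcont : Continuous fun ε : ℝ => ε * ((1 + collapseBound ν amax) * ‖vec α‖) +
      n / 2 * (ε ^ 2 * ‖π (vec k)‖ ^ 2 +
        (√ε * collapseBound ν amax + (√ε + ε) * ∑ i, ∑ j, k i j)) := by
    fun_prop
  have hlim := (hcont.tendsto 0).mono_left (nhdsWithin_le_nhds (s := Set.Ioi 0))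
  simp only [Real.sqrt_zero, zero_mul, mul_zero, add_zero, ne_eq, OfNat.ofNat_ne_zero,
    not_false_eq_true, zero_pow] at hlim
  refine hlim.congr' (eventually_mem_nhdsWithin.mono fun ε hε => ?_)
  have hε0 : ε ≠ 0 := ne_of_gt hε
  have hsqrt : 1 / √ε * ε = √ε := by rw [div_mul_eq_mul_div, one_mul, Real.div_sqrt]
  have hn : ε * (n / (2 * ε)) = n / 2 := by field_simp
  have hunused : (1 / √ε + 1) * (ε * ∑ i, ∑ j, k i j) = (√ε + ε) * ∑ i, ∑ j, k i j := by
    rw [← mul_assoc, add_mul, hsqrt, one_mul]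
  simp only [errorBound]
  rw [mul_add ε, ← mul_assoc ε (n / (2 * ε)), hn, hunused]


end SteadyState

section HeavyTraffic

variable {n amax : ℕ} {ν k α : Fin n → Fin n → ℝ} {ε : ℝ} {p : Fin n → Fin n → PMF ℕ}

theorem minEntry_le (x : Fin n → Fin n → ℝ) (i j : Fin n) : minEntry x ≤ x i j :=
  ciInf_le (Set.finite_range fun ij : Fin n × Fin n => x ij.1 ij.2).bddBelow (i, j)

theorem euclNorm_pos (hk : k ≠ 0) : 0 < euclNorm k := by
  rw [← norm_vec]
  exact norm_pos_iff.2 (vec.map_ne_zero_iff.2 hk)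

theorem epsMax_pos (hν : 0 < minEntry ν) (hk : k ≠ 0) : 0 < epsMax ν k :=
  div_pos hν (mul_pos two_pos (euclNorm_pos hk))

theorem mul_euclNorm_le_of_le_epsMax (hk : k ≠ 0) (hε : ε ≤ epsMax ν k) :
    ε * euclNorm k ≤ minEntry ν / 2 := by
  have h := (le_div_iff₀ (mul_pos two_pos (euclNorm_pos hk))).1 hε
  linarith

theorem isUnderloaded_sub_mul (hν : ν ∈ saturatedFace n n n) (hrow : ∀ i, 0 < ∑ j, k i j)
    (hcol : ∀ j, 0 < ∑ i, k i j) (hε : 0 < ε) : IsUnderloaded fun i j => ν i j - ε * k i j := by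
  refine ⟨fun i => ?_, fun j => ?_⟩
  · rw [Finset.sum_sub_distrib, ← Finset.mul_sum, hν.2.1 i i.2]
    exact sub_lt_self 1 (mul_pos hε (hrow i))
  · rw [Finset.sum_sub_distrib, ← Finset.mul_sum, hν.2.2 j j.2]
    exact sub_lt_self 1 (mul_pos hε (hcol j))

theorem IsSteadyState.abs_integral_weightedSum_sub_le_errorBound {P : MaxWeight n}
    {μ : Measure (QueueState n)} (hμ : IsSteadyState p P μ)
    (h : IsArrival amax (fun i j => ν i j - ε * k i j) p) (hν : ν ∈ saturatedFace n n n)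
    (hνmin : 0 < minEntry ν) (hk : k ≠ 0) (hε : ε ∈ Set.Ioc 0 (epsMax ν k))
    (hrow : ∀ i, ∑ j, α i j = n * ∑ j, k i j) (hcol : ∀ j, ∑ i, α i j = n * ∑ i, k i j) :
    Integrable (weightedSum α) μ ∧
      |∫ q, weightedSum α q ∂μ - (1 - 1 / (2 * n)) * (∑ i, ∑ j, arrivalVar p i j) / ε| ≤
        errorBound ν k α amax ε := by
  obtain ⟨hε0, hε1⟩ := hε
  have hεk := mul_euclNorm_le_of_le_epsMax hk hε1
  have hn : NeZero n := ⟨by rintro rfl; exact hk (Subsingleton.elim _ _)⟩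
  have hlam := hμ.isUnderloaded h (hμ.lt_one h hν hνmin (minEntry_le ν) hk hε0 hεk)
  obtain ⟨hd, hdM⟩ := hμ.integrable_collapseDist_sq h hν hνmin (minEntry_le ν) hε0.le hεk
  have hdrift := hμ.abs_two_mul_integral_inner_sub_le h hν hlam hd (Real.sqrt_pos.2 hε0)
  have hweight := hμ.abs_integral_weightedSum_sub_le h hlam hd hdM
    (starProjection_vec_eq_smul hrow hcol)
  refine ⟨hμ.integrable_weightedSum h hlam α, ?_⟩
  set J := ∫ q, ⟪(collapseSpace (Fin n) (Fin n)).starProjection (queueVec q), vec k⟫ ∂μ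
  set V := ∑ i, ∑ j, arrivalVar p i j
  set a := ε ^ 2 * ‖(collapseSpace (Fin n) (Fin n)).starProjection (vec k)‖ ^ 2
  have ha : 0 ≤ a := by positivity
  have hsplit : ∫ q, weightedSum α q ∂μ - (1 - 1 / (2 * n)) * V / ε =
      (∫ q, weightedSum α q ∂μ - n * J) + n / (2 * ε) * (a +
        (2 * ε * J - (a + (2 / n - 1 / n ^ 2) * V))) := by
    have := NeZero.ne (n : ℝ)
    field_simp
    ring
  rw [hsplit]
  refine (abs_add_le _ _).trans (add_le_add hweight ?_)
  rw [abs_mul, abs_of_pos (div_pos (Nat.cast_pos.2 (NeZero.pos n)) (mul_pos two_pos hε0))]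
  gcongr
  refine (abs_add_le _ _).trans (add_le_add (abs_of_nonneg ha).le (hdrift.trans ?_))
  gcongr
  exact hdM

theorem tendsto_mul_of_abs_sub_div_le {x s E : ℝ → ℝ} {s₀ : ℝ}
    (hx : ∀ᶠ ε in 𝓝[>] 0, |x ε - s ε / ε| ≤ E ε)
    (hE : Tendsto (fun ε => ε * E ε) (𝓝[>] 0) (𝓝 0)) (hs : Tendsto s (𝓝[>] 0) (𝓝 s₀)) :
    Tendsto (fun ε => ε * x ε) (𝓝[>] 0) (𝓝 s₀) := by
  have hdiff : Tendsto (fun ε => ε * x ε - s ε) (𝓝[>] 0) (𝓝 0) := by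
    refine squeeze_zero_norm' ?_ hE
    filter_upwards [hx, eventually_mem_nhdsWithin] with ε hxε (hε : 0 < ε)
    have hmul : ε * x ε - s ε = ε * (x ε - s ε / ε) := by field_simp
    rw [Real.norm_eq_abs, hmul, abs_mul, abs_of_pos hε]
    exact mul_le_mul_of_nonneg_left hxε hε.le
  simpa using hdiff.add hs

end HeavyTraffic

end Switch

open Switch MeasureTheory Filter Topology in
theorem mainTheorem4_general (n : ℕ) (ν k : Fin n → Fin n → ℝ)
    (hν : ν ∈ saturatedFace n n n) (hνmin : 0 < minEntry ν) (hk : k ≠ 0) (amax : ℕ) :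
    ((∀ i, 0 < ∑ j, k i j) → (∀ j, 0 < ∑ i, k i j) →
      ∀ ε ∈ Set.Ioc 0 (epsMax ν k), ∀ (p : Fin n → Fin n → PMF ℕ) (P : MaxWeight n),
        IsArrival amax (fun i j => ν i j - ε * k i j) p →
        ∃! μ : Measure (QueueState n), IsSteadyState p P μ) ∧
    ∀ α : Fin n → Fin n → ℝ,
      (∀ i, ∑ j, α i j = n * ∑ j, k i j) → (∀ j, ∑ i, α i j = n * ∑ i, k i j) →
      (∃ B₃ B₄ : ℝ → ℝ,
        Tendsto (fun ε => ε * B₃ ε) (𝓝[>] 0) (𝓝 0) ∧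
        Tendsto (fun ε => ε * B₄ ε) (𝓝[>] 0) (𝓝 0) ∧
        ∀ ε ∈ Set.Ioc 0 (epsMax ν k),
          ∀ (p : Fin n → Fin n → PMF ℕ) (P : MaxWeight n)
            (μ : Measure (QueueState n)),
            IsArrival amax (fun i j => ν i j - ε * k i j) p → IsSteadyState p P μ →
            Integrable (weightedSum α) μ ∧
            (1 - 1 / (2 * (n : ℝ))) * (∑ i, ∑ j, arrivalVar p i j) / ε - B₃ ε
              ≤ ∫ q, weightedSum α q ∂μ ∧
            ∫ q, weightedSum α q ∂μ
              ≤ (1 - 1 / (2 * (n : ℝ))) * (∑ i, ∑ j, arrivalVar p i j) / ε + B₄ ε) ∧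
      (∀ (p : ℝ → Fin n → Fin n → PMF ℕ) (P : ℝ → MaxWeight n)
        (μ : ℝ → Measure (QueueState n)) (σsq : Fin n → Fin n → ℝ),
        (∀ ε ∈ Set.Ioc 0 (epsMax ν k),
          IsArrival amax (fun i j => ν i j - ε * k i j) (p ε) ∧ IsSteadyState (p ε) (P ε) (μ ε)) →
        (∀ i j, Tendsto (fun ε => arrivalVar (p ε) i j) (𝓝[>] 0) (𝓝 (σsq i j))) →
        Tendsto (fun ε => ε * ∫ q, weightedSum α q ∂(μ ε)) (𝓝[>] 0)
          (𝓝 ((1 - 1 / (2 * (n : ℝ))) * ∑ i, ∑ j, σsq i j))) := by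
  refine ⟨fun hrow hcol ε hε p P h =>
      h.existsUnique_isSteadyState (isUnderloaded_sub_mul hν hrow hcol hε.1) P,
    fun α hrow hcol => ⟨?_, fun p P μ σsq hswitch hσ => ?_⟩⟩
  · refine ⟨errorBound ν k α amax, errorBound ν k α amax, tendsto_mul_errorBound ν k α amax,
      tendsto_mul_errorBound ν k α amax, fun ε hε p P μ h hμ => ?_⟩
    obtain ⟨hint, hbound⟩ :=
      hμ.abs_integral_weightedSum_sub_le_errorBound h hν hνmin hk hε hrow hcol
    obtain ⟨hlower, hupper⟩ := abs_sub_le_iff.1 hbound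
    exact ⟨hint, by linarith, by linarith⟩
  · refine tendsto_mul_of_abs_sub_div_le ?_ (tendsto_mul_errorBound ν k α amax)
      ((tendsto_finsetSum _ fun i _ => tendsto_finsetSum _ fun j _ => hσ i j).const_mul _)
    filter_upwards [Ioc_mem_nhdsGT (epsMax_pos hνmin hk)] with ε hε
    obtain ⟨h, hμ⟩ := hswitch ε hε
    exact (hμ.abs_integral_weightedSum_sub_le_errorBound h hν hνmin hk hε hrow hcol).2

theorem mainTheorem4 (n : ℕ) (hn : 1 ≤ n) (ν k : Fin n → Fin n → ℝ)
    (hν : ν ∈ intrinsicInterior ℝ (Switch.saturatedFace n n n))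
    (hνmin : 0 < Switch.minEntry ν)
    (hk : ∀ i j, 0 ≤ k i j) (hksum : ∑ i, ∑ j, k i j = (n : ℝ)) (amax : ℕ) :
    -- if all ports are underloaded, the chain has exactly one steady state
    ((∀ i, 0 < ∑ j, k i j) → (∀ j, 0 < ∑ i, k i j) →
      ∀ ε ∈ Set.Ioc 0 (Switch.epsMax ν k), ∀ (p : Fin n → Fin n → PMF ℕ) (P : Switch.MaxWeight n),
        Switch.IsArrival amax (fun i j => ν i j - ε * k i j) p →
        ∃! μ : MeasureTheory.Measure (Switch.QueueState n), Switch.IsSteadyState p P μ) ∧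
    ∀ α : Fin n → Fin n → ℝ,
      (∀ i, ∑ j, α i j = n * ∑ j, k i j) → (∀ j, ∑ i, α i j = n * ∑ i, k i j) →
      -- two-sided bounds for each system
      (∃ B₃ B₄ : ℝ → ℝ,
        Filter.Tendsto (fun ε => ε * B₃ ε) (nhdsWithin 0 (Set.Ioi 0)) (nhds 0) ∧
        Filter.Tendsto (fun ε => ε * B₄ ε) (nhdsWithin 0 (Set.Ioi 0)) (nhds 0) ∧
        ∀ ε ∈ Set.Ioc 0 (Switch.epsMax ν k),
          ∀ (p : Fin n → Fin n → PMF ℕ) (P : Switch.MaxWeight n)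
            (μ : MeasureTheory.Measure (Switch.QueueState n)),
            Switch.IsArrival amax (fun i j => ν i j - ε * k i j) p →
            Switch.IsSteadyState p P μ →
            MeasureTheory.Integrable (Switch.weightedSum α) μ ∧
            (1 - 1 / (2 * (n : ℝ))) * (∑ i, ∑ j, Switch.arrivalVar p i j) / ε - B₃ ε
              ≤ ∫ q, Switch.weightedSum α q ∂μ ∧
            ∫ q, Switch.weightedSum α q ∂μ
              ≤ (1 - 1 / (2 * (n : ℝ))) * (∑ i, ∑ j, Switch.arrivalVar p i j) / ε + B₄ ε) ∧
      -- the heavy-traffic limit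
      (∀ (p : ℝ → Fin n → Fin n → PMF ℕ) (P : ℝ → Switch.MaxWeight n)
        (μ : ℝ → MeasureTheory.Measure (Switch.QueueState n)) (σsq : Fin n → Fin n → ℝ),
        (∀ ε ∈ Set.Ioc 0 (Switch.epsMax ν k),
          Switch.IsArrival amax (fun i j => ν i j - ε * k i j) (p ε) ∧
          Switch.IsSteadyState (p ε) (P ε) (μ ε)) →
        (∀ i j, Filter.Tendsto (fun ε => Switch.arrivalVar (p ε) i j)
          (nhdsWithin 0 (Set.Ioi 0)) (nhds (σsq i j))) →
        Filter.Tendsto (fun ε => ε * ∫ q, Switch.weightedSum α q ∂(μ ε))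
          (nhdsWithin 0 (Set.Ioi 0))
          (nhds ((1 - 1 / (2 * (n : ℝ))) * ∑ i, ∑ j, σsq i j))) := by
  have hk0 : k ≠ 0 := by
    rintro rfl
    have hn0 : n = 0 := by simpa using hksum.symm
    exact Nat.ne_of_gt hn hn0
  exact mainTheorem4_general n ν k (intrinsicInterior_subset hν) hνmin hk0 amax
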